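/- Let $d\ge 1$ be an integer and put $D=2d+1$. Let $\ell^2(\mathbb Z^d,\mathbb C^{D})$ be the Hilbert space of square-summable functions $f:\mathbb Z^d\to\mathbb C^{D}$. Let $u_1,\dots,u_d$ be the standard basis of $\mathbb Z^d$, let $e_1,\dots,e_{D}$ be the standard orthonormal basis of $\mathbb C^{D}$, and let $P_i$ be the orthogonal projection of $\mathbb C^{D}$ onto $\mathbb C e_i$. For $\alpha\in\mathbb Z^d$ let $(\tau^\alpha f)(x)=f(x-\alpha)$; a $D\times D$ matrix acts on $\ell^2(\mathbb Z^d,\mathbb C^{D})$ by $(Af)(x)=A(f(x))$. Put $S_{\rm lazy}=\{\pm u_1,\dots,\pm u_d\}\cup\{0\}$, and let $\mathcal P_{\rm lazy}=\{P_\alpha\}_{\alpha\in S_{\rm lazy}}$ be given by $P_{u_j}=P_j$, $P_0=P_{d+1}$, $P_{-u_j}=P_{d+1+j}$ $(1\le j\le d)$. Let $G_{D}=\frac{2}{D}J-I$ be the Grover matrix, where $J$ is the $D\times D$ matrix all of whose entries are $1$. The lazy Grover walk is the operator $$U=U(S_{\rm lazy},\mathcal P_{\rm lazy},G_{2d+1})=\Bigl(\sum_{\alpha\in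 S_{\rm lazy}}\tau^\alpha P_\alpha\Bigr)G_{2d+1}\quad\text{on } \ell^2(\mathbb Z^d,\mathbb C^{2d+1}).$$ For $\phi\in\mathbb C^{2d+1}$ let $\delta_0\otimes\phi$ be the function with value $\phi$ at $0$ and $0$ elsewhere, and let $p_n(\phi;x)=\|U^n(\delta_0\otimes\phi)(x)\|^2_{\mathbb C^{2d+1}}$. Then $1$ is an eigenvalue of $U$, and $U$ has no other eigenvalues. Moreover, if $\Pi_+$ denotes the orthogonal projection of $\ell^2(\mathbb Z^d,\mathbb C^{2d+1})$ onto the eigenspace of $U$ with eigenvalue $1$, then $$\lim_{n\to\infty}p_n(\phi;x)=\|\Pi_+(\delta_0\otimes\phi)(x)\|^2_{\mathbb C^{2d+1}}$$ for every $\phi\in\mathbb C^{2d+1}$ and every $x\in\mathbb Z^d$. -/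

import Mathlib

/-- The Hilbert space `ℓ²(ℤᵈ, ℂᴰ)`. -/
abbrev WalkSpace (d D : ℕ) : Type :=
  lp (fun _ : Fin d → ℤ => EuclideanSpace ℂ (Fin D)) 2

namespace QuantumWalk

theorem memlp_translate {d D : ℕ} (α : Fin d → ℤ) (f : WalkSpace d D) :
    Memℓp (fun x : Fin d → ℤ => f (x - α)) 2 := by
  have h := (memℓp_gen_iff (p := 2) (by norm_num)).1 (lp.memℓp f)
  exact (memℓp_gen_iff (p := 2) (by norm_num)).2 ((Equiv.subRight α).summable_iff.2 h)

/-- The translation `(τ^α f)(x) = f(x - α)` as a bounded operator on `ℓ²(ℤᵈ, ℂᴰ)`. -/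
noncomputable def translate {d D : ℕ} (α : Fin d → ℤ) :
    WalkSpace d D →L[ℂ] WalkSpace d D :=
  LinearMap.mkContinuous
    { toFun := fun f => ⟨fun x => f (x - α), memlp_translate α f⟩
      map_add' := fun _ _ => rfl
      map_smul' := fun _ _ => rfl } 1 (by
    intro f
    rw [one_mul, lp.norm_eq_tsum_rpow (by norm_num), lp.norm_eq_tsum_rpow (by norm_num)]
    exact le_of_eq (congrArg (· ^ _)
      ((Equiv.subRight α).tsum_eq (fun x => ‖f x‖ ^ (2 : ENNReal).toReal))))

theorem translate_apply {d D : ℕ} (α : Fin d → ℤ) (f : WalkSpace d D) (x : Fin d → ℤ) :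
    translate α f x = f (x - α) := rfl

/-- The operator `(A f)(x) = A (f x)` on `ℓ²(ℤᵈ, ℂᴰ)` given by a linear operator `A` on `ℂᴰ`. -/
noncomputable def fiberwise {d D : ℕ}
    (A : EuclideanSpace ℂ (Fin D) →L[ℂ] EuclideanSpace ℂ (Fin D)) :
    WalkSpace d D →L[ℂ] WalkSpace d D :=
  lp.mapCLM 2 (fun _ : Fin d → ℤ => A) (norm_nonneg A) (fun _ => le_rfl)

theorem fiberwise_apply {d D : ℕ}
    (A : EuclideanSpace ℂ (Fin D) →L[ℂ] EuclideanSpace ℂ (Fin D)) (f : WalkSpace d D)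
    (x : Fin d → ℤ) : fiberwise A f x = A (f x) := rfl

/-- The shift operator `∑_{α ∈ S} τ^α P_α` on `ℓ²(ℤᵈ, ℂᴰ)`. -/
noncomputable def shift {d D : ℕ} (S : Finset (Fin d → ℤ))
    (P : (Fin d → ℤ) → (EuclideanSpace ℂ (Fin D) →L[ℂ] EuclideanSpace ℂ (Fin D))) :
    WalkSpace d D →L[ℂ] WalkSpace d D :=
  ∑ α ∈ S, translate α ∘L fiberwise (P α)

/-- The time evolution `U(S, P, C) = (∑_{α ∈ S} τ^α P_α) C` on `ℓ²(ℤᵈ, ℂᴰ)`; only the values of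
`P` on `S` matter. -/
noncomputable def evolution {d D : ℕ} (S : Finset (Fin d → ℤ))
    (P : (Fin d → ℤ) → (EuclideanSpace ℂ (Fin D) →L[ℂ] EuclideanSpace ℂ (Fin D)))
    (C : Matrix (Fin D) (Fin D) ℂ) : WalkSpace d D →L[ℂ] WalkSpace d D :=
  shift S P ∘L fiberwise (Matrix.toEuclideanCLM (𝕜 := ℂ) C)

/-- The state `δ_z ⊗ φ`, equal to `φ` at `z` and to `0` elsewhere. -/
noncomputable def deltaState {d D : ℕ} (z : Fin d → ℤ) (φ : EuclideanSpace ℂ (Fin D)) :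
    WalkSpace d D :=
  lp.single 2 z φ

/-- `p_n(φ; x) = ‖Uⁿ (δ₀ ⊗ φ)(x)‖²`. -/
noncomputable def prob {d D : ℕ} (U : WalkSpace d D →L[ℂ] WalkSpace d D) (n : ℕ)
    (φ : EuclideanSpace ℂ (Fin D)) (x : Fin d → ℤ) : ℝ :=
  ‖(U ^ n) (deltaState 0 φ) x‖ ^ 2

/-- The eigenspace `{f | U f = ω f}` of a bounded operator. -/
noncomputable abbrev eigenspace {d D : ℕ} (U : WalkSpace d D →L[ℂ] WalkSpace d D) (ω : ℂ) :
    Submodule ℂ (WalkSpace d D) :=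
  Module.End.eigenspace (U : WalkSpace d D →ₗ[ℂ] WalkSpace d D) ω

theorem isClosed_eigenspace {d D : ℕ} (U : WalkSpace d D →L[ℂ] WalkSpace d D) (ω : ℂ) :
    IsClosed (eigenspace U ω : Set (WalkSpace d D)) := by
  have h : (eigenspace U ω : Set (WalkSpace d D)) = {f | U f = ω • f} := by
    ext f
    exact Module.End.mem_eigenspace_iff
  rw [h]
  exact isClosed_eq U.continuous (continuous_const_smul ω)

instance hasOrthogonalProjection_eigenspace {d D : ℕ}
    (U : WalkSpace d D →L[ℂ] WalkSpace d D) (ω : ℂ) :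
    (eigenspace U ω).HasOrthogonalProjection :=
  haveI : CompleteSpace (eigenspace U ω) := (isClosed_eigenspace U ω).completeSpace_coe
  inferInstance

/-- The orthogonal projection of `ℓ²(ℤᵈ, ℂᴰ)` onto the eigenspace of `U` for `ω`. -/
noncomputable def eigenProj {d D : ℕ} (U : WalkSpace d D →L[ℂ] WalkSpace d D) (ω : ℂ) :
    WalkSpace d D →L[ℂ] WalkSpace d D :=
  (eigenspace U ω).starProjection

/-- The Grover matrix `(2 / D) J - I`, where `J` is the all-ones matrix. -/
noncomputable def grover (D : ℕ) : Matrix (Fin D) (Fin D) ℂ :=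
  (2 / (D : ℂ)) • Matrix.of (fun _ _ => 1) - 1

/-- The orthogonal projection of `ℂᴰ` onto the line spanned by the `i`-th standard basis vector. -/
noncomputable def coordProj {D : ℕ} (i : Fin D) :
    EuclideanSpace ℂ (Fin D) →L[ℂ] EuclideanSpace ℂ (Fin D) :=
  (Submodule.span ℂ {EuclideanSpace.single i (1 : ℂ)}).starProjection

/-- The standard basis vector `u_j` of `ℤᵈ`. -/
def unitStep {d : ℕ} (j : Fin d) : Fin d → ℤ := Pi.single j 1

/-- The set of steps `{±u_1, …, ±u_d} ∪ {0}`. -/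
def lazySteps (d : ℕ) : Finset (Fin d → ℤ) :=
  (Finset.univ.image (fun j : Fin d => unitStep j) ∪
    Finset.univ.image (fun j : Fin d => -unitStep j)) ∪ {0}

/-- The step attached to each basis vector of `ℂ^{2d+1}`. With indices counted from `0`, the
indices `j`, `d` and `d + 1 + j` (where `j < d`) have the steps `u_j`, `0` and `-u_j`. -/
def lazyStep {d : ℕ} (i : Fin (2 * d + 1)) : Fin d → ℤ :=
  if h : i.val < d then unitStep ⟨i.val, h⟩
  else if h' : i.val = d then 0
  else -unitStep ⟨i.val - (d + 1), by have := i.isLt; omega⟩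

/-- The resolution of unity of the lazy walk: `P_α` is the coordinate projection belonging to the
basis vector whose step is `α`. The values are computed in `lazyProj_unitStep`, `lazyProj_zero`
and `lazyProj_neg_unitStep`. -/
noncomputable def lazyProj (d : ℕ) (α : Fin d → ℤ) :
    EuclideanSpace ℂ (Fin (2 * d + 1)) →L[ℂ] EuclideanSpace ℂ (Fin (2 * d + 1)) :=
  ∑ i : Fin (2 * d + 1), if lazyStep i = α then coordProj i else 0

theorem unitStep_apply_self {d : ℕ} (j : Fin d) : unitStep j j = 1 := by
  simp [unitStep]

theorem unitStep_nonneg {d : ℕ} (j k : Fin d) : 0 ≤ unitStep j k := by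
  simp only [unitStep, Pi.single_apply]
  split_ifs <;> norm_num

theorem unitStep_injective {d : ℕ} {j k : Fin d} (h : unitStep j = unitStep k) : j = k := by
  by_contra hjk
  have := congrFun h j
  simp [unitStep, hjk] at this

theorem lazyStep_injective {d : ℕ} : Function.Injective (lazyStep (d := d)) := by
  have h0 : ∀ j : Fin d, unitStep j ≠ 0 := fun j h => by
    have := congrFun h j
    rw [unitStep_apply_self] at this
    exact one_ne_zero this
  have hn : ∀ j k : Fin d, unitStep j ≠ -unitStep k := fun j k h => by
    have := congrFun h j
    rw [unitStep_apply_self, Pi.neg_apply] at this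
    have := unitStep_nonneg k j
    omega
  intro a b hab
  unfold lazyStep at hab
  split_ifs at hab with h1 h2 h3 h4 h5 h6 h7 h8
  · have := unitStep_injective hab
    simp only [Fin.mk.injEq] at this
    exact Fin.ext this
  · exact absurd hab (h0 _)
  · exact absurd hab (hn _ _)
  · exact absurd hab.symm (h0 _)
  · exact Fin.ext (by omega)
  · exact absurd (neg_eq_zero.1 hab.symm) (h0 _)
  · exact absurd hab.symm (hn _ _)
  · exact absurd (neg_eq_zero.1 hab) (h0 _)
  · have := unitStep_injective (neg_inj.1 hab)
    simp only [Fin.mk.injEq] at this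
    exact Fin.ext (by omega)

theorem lazyProj_lazyStep {d : ℕ} (i : Fin (2 * d + 1)) :
    lazyProj d (lazyStep i) = coordProj i := by
  simp [lazyProj, lazyStep_injective.eq_iff]

theorem lazyProj_unitStep {d : ℕ} (j : Fin d) :
    lazyProj d (unitStep j) = coordProj ⟨j.val, by have := j.isLt; omega⟩ := by
  rw [← lazyProj_lazyStep]
  simp [lazyStep]

theorem lazyProj_zero {d : ℕ} :
    lazyProj d 0 = coordProj ⟨d, by omega⟩ := by
  rw [← lazyProj_lazyStep]
  simp [lazyStep]

theorem lazyProj_neg_unitStep {d : ℕ} (j : Fin d) :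
    lazyProj d (-unitStep j) = coordProj ⟨d + 1 + j.val, by have := j.isLt; omega⟩ := by
  rw [← lazyProj_lazyStep]
  congr 1
  have h1 : ¬ d + 1 + j.val < d := by omega
  have h2 : ¬ d + 1 + j.val = d := by omega
  simp [lazyStep, h1, h2]

/-- The lazy Grover walk `U(S_lazy, P_lazy, G_{2d+1})` on `ℓ²(ℤᵈ, ℂ^{2d+1})`. -/
noncomputable def lazyGrover (d : ℕ) :
    WalkSpace d (2 * d + 1) →L[ℂ] WalkSpace d (2 * d + 1) :=
  evolution (lazySteps d) (lazyProj d) (grover (2 * d + 1))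

end QuantumWalk

/-! The proof replaces Fourier analysis by algebra over the commutative ring of symbols generated by
a time shift `T` and the space shifts `z_j`.

Dispersion relation. The coin sends `v` to `σ - v` in every component, where `σ` is `2/D` times the
sum of the components of `v`. In the variables `e = 2v - σ` one step of the walk becomes a linear
system over the symbols, and elimination shows that `p = (T - 1) R` annihilates the walk, with `t_j
= z_j + z_j⁻¹`, `w_j = T² + 1 + T t_j` and `R = ∏ w_j + 2 (T + 1)² ∑_j ∏_{l ≠ j} w_l`
(`fieldHom_dispSymbol`). The factor `T - 1` is the flat band that yields the eigenvalue 1.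

Decay. Let `X` be multiplication by the coordinate `x_j`, and let `v` be the derivative of `p` in
the `j`-th quasi-momentum, up to a constant. Commuting `X` through `p(U) = 0` and dividing `p(S') -
p(S)` by `S' - S`, for two independent time shifts, gives a telescoping identity in which `n + 1`
equal copies of `(Uⁿ v f)(x)` add up to a bounded quantity. Hence `(Uⁿ v f)(x) = O(1/n)` for
finitely supported `f` (`tendsto_lazyGrover_pow_velocity`), and by density and unitarity every
vector in the closed range of `v` decays pointwise.

Kernel. Since `v` is normal, the closure of its range is the orthogonal complement of its kernel.
The kernel lies in the eigenspace for 1 (`lazyGrover_apply_eq_of_velocity`), because the reduced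
polynomials with and without the coordinate `j` have no common kernel on square-summable functions.

Thus everything orthogonal to the eigenspace for 1 decays pointwise. This gives the limit, and it
excludes other eigenvalues because an eigenvector of a unitary operator has constant modulus in
time. An explicit state on the cube `{0, 1}ᵈ` shows that 1 is an eigenvalue. -/

namespace QuantumWalk

open scoped InnerProductSpace

/-! ### Elimination and the dispersion polynomial over a commutative ring -/

section ModuleAlgebra

variable {K M ι : Type*} [CommRing K] [AddCommGroup M] [Module K M]

/-- The factor `T² + 1 + T t` of the dispersion polynomial. -/
def dispFactor (T : K) (t : ι → K) (j : ι) : K := T ^ 2 + 1 + T * t j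

theorem dispFactor_smul_add {T : K} {z z' : ι → K} {e e' : ι → M} {σ : M} (hz : ∀ j, z j * z' j = 1)
    (h : ∀ j, (T + z j) • e j + (T - z j) • σ = 0)
    (h' : ∀ j, (T + z' j) • e' j + (T - z' j) • σ = 0) (j : ι) :
    dispFactor T (fun j => z j + z' j) j • (e j + e' j) + (2 * (T ^ 2 - 1)) • σ = 0 := by
  have hw : dispFactor T (fun j => z j + z' j) j = (T + z j) * (T + z' j) := by
    unfold dispFactor; linear_combination -hz j
  have hv : 2 * (T ^ 2 - 1) = (T - z j) * (T + z' j) + (T + z j) * (T - z' j) := by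
    linear_combination 2 * hz j
  rw [hw, hv]
  linear_combination (norm := module) (T + z' j) • h j + (T + z j) • h' j

variable [DecidableEq ι]

/-- The sum over `j ∈ s` of the products of `w` over `s` without `j`. -/
def sumProdErase (w : ι → K) (s : Finset ι) : K := ∑ j ∈ s, ∏ l ∈ s.erase j, w l

theorem sumProdErase_insert (w : ι → K) {s : Finset ι} {i : ι} (hi : i ∉ s) :
    sumProdErase w (insert i s) = w i * sumProdErase w s + ∏ l ∈ s, w l := by
  unfold sumProdErase
  rw [Finset.sum_insert hi, Finset.erase_insert hi, add_comm, Finset.mul_sum]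
  congr 1
  refine Finset.sum_congr rfl fun j hj => ?_
  have hij : i ≠ j := fun h => hi (h ▸ hj)
  rw [Finset.erase_insert_of_ne hij, Finset.prod_insert (fun h => hi (Finset.mem_of_mem_erase h))]

/-- The reduced dispersion polynomial of the coordinates in `s`. -/
def reducedDisp (T : K) (t : ι → K) (s : Finset ι) : K :=
  ∏ j ∈ s, dispFactor T t j + 2 * (T + 1) ^ 2 * sumProdErase (dispFactor T t) s

theorem reducedDisp_insert (T : K) (t : ι → K) {s : Finset ι} {i : ι} (hi : i ∉ s) :
    reducedDisp T t (insert i s) = dispFactor T t i * reducedDisp T t s +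
      2 * (T + 1) ^ 2 * ∏ j ∈ s, dispFactor T t j := by
  unfold reducedDisp
  rw [sumProdErase_insert _ hi, Finset.prod_insert hi]
  ring

theorem prod_smul_sum_add (w : ι → K) (v : K) (e : ι → M) (σ : M) (s : Finset ι)
    (h : ∀ j ∈ s, w j • e j + v • σ = 0) :
    (∏ j ∈ s, w j) • ∑ j ∈ s, e j + (v * sumProdErase w s) • σ = 0 := by
  induction s using Finset.induction_on with
  | empty => simp [sumProdErase]
  | insert i s hi ih =>
    have h1 := ih fun j hj => h j (Finset.mem_insert_of_mem hj)
    have h2 := h i (Finset.mem_insert_self i s)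
    rw [sumProdErase_insert _ hi, Finset.prod_insert hi, Finset.sum_insert hi]
    linear_combination (norm := module) (w i) • h1 + (∏ l ∈ s, w l) • h2

section Annihilation

variable [Fintype ι] {T : K} {z z' : ι → K} {e e' : ι → M} {e₀ σ : M}

/-- Clearing denominators in `∑ (e_j + e'_j) = -e₀` leaves two equations in `e₀` and `σ`, and `(T -
1) R` is their determinant up to sign. No division occurs, so zero divisors and torsion do no harm.
-/
theorem disp_smul_center (hz : ∀ j, z j * z' j = 1)
    (h : ∀ j, (T + z j) • e j + (T - z j) • σ = 0)
    (h' : ∀ j, (T + z' j) • e' j + (T - z' j) • σ = 0)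
    (h₀ : (T + 1) • e₀ + (T - 1) • σ = 0) (hsum : ∑ j, (e j + e' j) + e₀ = 0) :
    ((T - 1) * reducedDisp T (fun j => z j + z' j) Finset.univ) • σ = 0 ∧
    ((T - 1) * reducedDisp T (fun j => z j + z' j) Finset.univ) • e₀ = 0 := by
  have h1 := prod_smul_sum_add _ _ (fun j => e j + e' j) σ Finset.univ
    fun j _ => dispFactor_smul_add hz h h' j
  rw [eq_neg_of_add_eq_zero_left hsum] at h1
  unfold reducedDisp
  constructor
  · linear_combination (norm := module) (T + 1) • h1 +
      (∏ j, dispFactor T (fun j => z j + z' j) j) • h₀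
  · linear_combination (norm := module) -(T - 1) • h1 +
      (2 * (T ^ 2 - 1) * sumProdErase (dispFactor T (fun j => z j + z' j)) Finset.univ) • h₀

/-- Eliminating all coordinates except `j` leaves three equations in `e_j`, `e'_j` and `σ`, to which
Cramer's rule applies. -/
theorem disp_smul_side (hz : ∀ j, z j * z' j = 1)
    (h : ∀ j, (T + z j) • e j + (T - z j) • σ = 0)
    (h' : ∀ j, (T + z' j) • e' j + (T - z' j) • σ = 0)
    (h₀ : (T + 1) • e₀ + (T - 1) • σ = 0) (hsum : ∑ j, (e j + e' j) + e₀ = 0) (j : ι) :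
    ((T - 1) * reducedDisp T (fun j => z j + z' j) Finset.univ) • e j = 0 := by
  have h1 := prod_smul_sum_add _ _ (fun j => e j + e' j) σ (Finset.univ.erase j)
    fun j _ => dispFactor_smul_add hz h h' j
  have hs : ∑ i ∈ Finset.univ.erase j, (e i + e' i) = -e₀ - (e j + e' j) := by
    rw [← Finset.add_sum_erase _ _ (Finset.mem_univ j)] at hsum
    linear_combination (norm := module) hsum
  rw [hs] at h1
  rw [← Finset.insert_erase (Finset.mem_univ j),
    reducedDisp_insert _ _ (Finset.notMem_erase j Finset.univ)]
  unfold reducedDisp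
  set A := ∏ j ∈ Finset.univ.erase j, dispFactor T (fun j => z j + z' j) j
  set D := sumProdErase (dispFactor T (fun j => z j + z' j)) (Finset.univ.erase j)
  have hw : dispFactor T (fun j => z j + z' j) j = (T + z j) * (T + z' j) := by
    unfold dispFactor; linear_combination -hz j
  have hv : 2 * (T ^ 2 - 1) = (T - z j) * (T + z' j) + (T + z j) * (T - z' j) := by
    linear_combination 2 * hz j
  have h2 : ((T + 1) * A) • (-(e j + e' j)) +
      ((T - 1) * A + (T + 1) * (2 * (T ^ 2 - 1)) * D) • σ = 0 := by
    linear_combination (norm := module) (T + 1) • h1 + A • h₀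
  -- The right-hand side is the determinant of the system formed by `h2`, `h j` and `h' j`. The
  -- final linear combination takes its coefficients from the cofactors.
  have h3 : ((T - 1) * (dispFactor T (fun j => z j + z' j) j * (A + 2 * (T + 1) ^ 2 * D) +
      2 * (T + 1) ^ 2 * A)) =
      ((T - z j) * (T + z' j) + (T + z j) * (T - z' j)) * ((T + 1) * A) +
      (T + z j) * (T + z' j) * ((T - 1) * A + (T + 1) * (2 * (T ^ 2 - 1)) * D) := by
    rw [hw, ← hv]; ring
  rw [h3]
  set B := (T - 1) * A + (T + 1) * (2 * (T ^ 2 - 1)) * D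
  set A' := (T + 1) * A
  linear_combination (norm := module) (-(T - z j) * (T + z' j)) • h2 + ((T - z' j) * A') • h j +
    ((T + z' j) * B) • h j - ((T - z j) * A') • h' j

end Annihilation

theorem smul_prod_injOn (N : Submodule K M) (w : ι → K) (s : Finset ι)
    (h : ∀ j ∈ s, ∀ y ∈ N, w j • y = 0 → y = 0) :
    ∀ y ∈ N, (∏ j ∈ s, w j) • y = 0 → y = 0 := by
  induction s using Finset.induction_on with
  | empty => simp
  | insert i s hi ih =>
    intro y hy h0
    rw [Finset.prod_insert hi, mul_smul] at h0
    have h1 := h i (Finset.mem_insert_self i s) _ (N.smul_mem _ hy) h0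
    exact ih (fun j hj => h j (Finset.mem_insert_of_mem hj)) y hy h1

/-- By the recursion for `R`, a common kernel vector satisfies `2 (T + 1)² ∏_{j ∈ s} w_j y = 0`. It
therefore suffices that `T + 1` and each `w_j` act injectively on the kernel of `R_s`. This reduces
to the injectivity of `T`, `t_j - 2` and `t_l - t_j`, which play the role of nonvanishing almost
everywhere in momentum space. -/
theorem eq_zero_of_reducedDisp_smul {T : K} {t : ι → K} {s : Finset ι} {i : ι} (hi : i ∉ s)
    (h2 : ∀ y : M, (2 : K) • y = 0 → y = 0) (hT : ∀ y : M, T • y = 0 → y = 0)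
    (ht : ∀ j ∈ s, ∀ y : M, (t j - 2) • y = 0 → y = 0)
    (htt : ∀ j ∈ s, ∀ l ∈ s, l ≠ j → ∀ y : M, (t l - t j) • y = 0 → y = 0) (y : M)
    (hs : reducedDisp T t s • y = 0) (his : reducedDisp T t (insert i s) • y = 0) : y = 0 := by
  have hT1 : ∀ j ∈ s, ∀ y : M, (T + 1) • y = 0 → dispFactor T t j • y = 0 → y = 0 := by
    intro j hj y h1 hw
    refine ht j hj y ?_
    -- At `T = -1` the factor `w_j` equals `2 - t_j`.
    have : t j - 2 = (T - 1 + t j) * (T + 1) - dispFactor T t j := by unfold dispFactor; ring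
    rw [this, sub_smul, mul_smul, h1, hw]; simp
  have key1 : ∀ y : M, reducedDisp T t s • y = 0 → (T + 1) • y = 0 → y = 0 := by
    intro y h1 h3
    refine smul_prod_injOn (LinearMap.ker (LinearMap.lsmul K M (T + 1))) (dispFactor T t) s
      (fun j hj y hy => hT1 j hj y hy) y h3 ?_
    have : ∏ j ∈ s, dispFactor T t j = reducedDisp T t s -
        2 * (T + 1) * sumProdErase (dispFactor T t) s * (T + 1) := by unfold reducedDisp; ring
    rw [this, sub_smul, mul_smul _ (T + 1), h1, h3]; simp
  have key2 : ∀ j ∈ s, ∀ y : M, reducedDisp T t s • y = 0 → dispFactor T t j • y = 0 → y = 0 := by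
    intro j hj y h1 h3
    refine smul_prod_injOn (LinearMap.ker (LinearMap.lsmul K M (dispFactor T t j)))
      (dispFactor T t) (s.erase j) (fun l hl y hy hly => ?_) y h3 ?_
    · refine htt j hj l (Finset.mem_of_mem_erase hl) (Finset.ne_of_mem_erase hl) y (hT _ ?_)
      have hy' : dispFactor T t j • y = 0 := hy
      have : T * (t l - t j) = dispFactor T t l - dispFactor T t j := by unfold dispFactor; ring
      rw [← mul_smul, this, sub_smul, hly, hy', sub_zero]
    -- On the kernel of `w_j` only the term `2 (T + 1)² ∏_{l ≠ j} w_l` of `R_s` survives, and `T +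
    -- 1` is injective there by `hT1`.
    · rw [← Finset.insert_erase hj, reducedDisp_insert _ _ (Finset.notMem_erase j s), add_smul,
        mul_comm (dispFactor T t j), mul_smul, h3, smul_zero, zero_add] at h1
      refine hT1 j hj _ (hT1 j hj _ (h2 _ ?_) ?_) ?_
      · rw [← h1]; module
      · rw [smul_comm, smul_comm (dispFactor T t j), h3, smul_zero, smul_zero]
      · rw [smul_comm, h3, smul_zero]
  have key : ∀ y : M, reducedDisp T t s • y = 0 → (∏ j ∈ s, dispFactor T t j) • y = 0 → y = 0 :=
    fun y => smul_prod_injOn (LinearMap.ker (LinearMap.lsmul K M (reducedDisp T t s))) _ s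
      (fun j hj y hy => key2 j hj y hy) y
  have comm : ∀ (k : K), reducedDisp T t s • k • y = 0 := fun k => by
    rw [smul_comm, hs, smul_zero]
  rw [reducedDisp_insert _ _ hi, add_smul, mul_smul, hs, smul_zero, zero_add] at his
  refine key y hs (key1 _ (comm _) (key1 _ ?_ (h2 _ ?_)))
  · rw [smul_comm _ (T + 1), comm, smul_zero]
  · rw [← his]; module

end ModuleAlgebra

/-! ### The walk as a local rule on arbitrary functions -/

/-- All functions `ℤᵈ → ℂ^{2d+1}`, without a summability condition. -/
abbrev StateField (d : ℕ) : Type := (Fin d → ℤ) → EuclideanSpace ℂ (Fin (2 * d + 1))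

theorem coordProj_apply {D : ℕ} (i : Fin D) (v : EuclideanSpace ℂ (Fin D)) :
    coordProj i v = EuclideanSpace.single i (v i) := by
  rw [coordProj, Submodule.starProjection_unit_singleton ℂ (by simp)]
  ext k
  simp [EuclideanSpace.inner_single_left]

theorem lazySteps_eq_image (d : ℕ) : lazySteps d = Finset.univ.image (lazyStep (d := d)) := by
  ext α
  simp only [lazySteps, Finset.mem_union, Finset.mem_image, Finset.mem_univ, true_and,
    Finset.mem_singleton]
  constructor
  · rintro ((⟨j, rfl⟩ | ⟨j, rfl⟩) | rfl)
    · exact ⟨⟨j.val, by omega⟩, by simp [lazyStep]⟩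
    · refine ⟨⟨d + 1 + j.val, by omega⟩, ?_⟩
      have h1 : ¬ d + 1 + j.val < d := by omega
      have h2 : ¬ d + 1 + j.val = d := by omega
      simp [lazyStep, h1, h2]
    · exact ⟨⟨d, by omega⟩, by simp [lazyStep]⟩
  · rintro ⟨i, rfl⟩
    unfold lazyStep
    split_ifs
    · exact Or.inl (Or.inl ⟨_, rfl⟩)
    · exact Or.inr rfl
    · exact Or.inl (Or.inr ⟨_, rfl⟩)

theorem shift_eq_sum (d : ℕ) :
    shift (lazySteps d) (lazyProj d) =
      ∑ i : Fin (2 * d + 1), translate (lazyStep i) ∘L fiberwise (coordProj i) := by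
  rw [shift, lazySteps_eq_image, Finset.sum_image fun a _ b _ h => lazyStep_injective h]
  simp only [lazyProj_lazyStep]

/-- The `i`-th component of the coin operator. -/
noncomputable def coinPart {d : ℕ} (i : Fin (2 * d + 1)) :
    EuclideanSpace ℂ (Fin (2 * d + 1)) →L[ℂ] EuclideanSpace ℂ (Fin (2 * d + 1)) :=
  coordProj i ∘L Matrix.toEuclideanCLM (𝕜 := ℂ) (grover (2 * d + 1))

theorem coinPart_apply {d : ℕ} (i k : Fin (2 * d + 1)) (v : EuclideanSpace ℂ (Fin (2 * d + 1))) :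
    coinPart i v k = if k = i then 2 / (2 * d + 1 : ℂ) * ∑ l, v l - v i else 0 := by
  rw [coinPart, ContinuousLinearMap.comp_apply, coordProj_apply]
  simp only [PiLp.single_apply]
  split_ifs with h
  · simp [grover, Matrix.mulVec, dotProduct, Finset.mul_sum]
  · rfl

/-- One step of the lazy Grover walk on arbitrary functions. -/
noncomputable def step (d : ℕ) : Module.End ℂ (StateField d) where
  toFun f x := ∑ i, coinPart i (f (x - lazyStep i))
  map_add' f g := by
    ext1 x
    simp [Finset.sum_add_distrib]
  map_smul' c f := by
    ext1 x
    simp [Finset.smul_sum]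

theorem step_apply {d : ℕ} (f : StateField d) (x : Fin d → ℤ) :
    step d f x = ∑ i, coinPart i (f (x - lazyStep i)) := rfl

theorem step_apply_apply {d : ℕ} (f : StateField d) (x : Fin d → ℤ) (k : Fin (2 * d + 1)) :
    step d f x k = 2 / (2 * d + 1 : ℂ) * ∑ l, f (x - lazyStep k) l - f (x - lazyStep k) k := by
  rw [step_apply, WithLp.ofLp_sum, Finset.sum_apply]
  simp [coinPart_apply]

theorem coe_sum {d D : ℕ} {ι : Type*} (s : Finset ι) (f : ι → WalkSpace d D) (x : Fin d → ℤ) :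
    (∑ i ∈ s, f i : WalkSpace d D) x = ∑ i ∈ s, f i x := by
  rw [lp.coeFn_sum, Finset.sum_apply]

theorem coe_lazyGrover {d : ℕ} (f : WalkSpace d (2 * d + 1)) :
    ⇑(lazyGrover d f) = step d ⇑f := by
  ext1 x
  rw [lazyGrover, evolution, shift_eq_sum, ContinuousLinearMap.comp_apply,
    sum_apply, coe_sum]
  rfl

theorem coe_lazyGrover_pow {d : ℕ} (n : ℕ) (f : WalkSpace d (2 * d + 1)) :
    ⇑((lazyGrover d ^ n) f) = (step d ^ n) ⇑f := by
  induction n with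
  | zero => rfl
  | succ n ih => rw [pow_succ', pow_succ', mul_apply_eq_comp, coe_lazyGrover, ih]; rfl

/-- Translations of arbitrary functions, `(τ f)(x) = f (x + α)`. -/
noncomputable def fieldTranslate (d : ℕ) :
    Multiplicative (Fin d → ℤ) →* Module.End ℂ (StateField d) where
  toFun α :=
    { toFun := fun f x => f (x + α.toAdd)
      map_add' := fun _ _ => rfl
      map_smul' := fun _ _ => rfl }
  map_one' := by
    ext1 f
    funext x
    simp
  map_mul' α β := by
    ext1 f
    funext x
    simp [add_assoc]

theorem fieldTranslate_apply {d : ℕ} (α : Multiplicative (Fin d → ℤ)) (f : StateField d)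
    (x : Fin d → ℤ) : fieldTranslate d α f x = f (x + α.toAdd) := rfl

/-- Translations of square-summable functions, `(τ f)(x) = f (x + α)`. -/
noncomputable def walkTranslate (d D : ℕ) :
    Multiplicative (Fin d → ℤ) →* (WalkSpace d D →L[ℂ] WalkSpace d D) where
  toFun α := translate (-α.toAdd)
  map_one' := by
    ext1 f
    ext1
    funext x
    simp [translate_apply]
  map_mul' α β := by
    ext1 f
    ext1
    funext x
    simp only [translate_apply, mul_apply_eq_comp, toAdd_mul]
    rw [show x - -(α.toAdd + β.toAdd) = x - -α.toAdd - -β.toAdd by abel]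

theorem walkTranslate_apply {d D : ℕ} (α : Multiplicative (Fin d → ℤ)) (f : WalkSpace d D)
    (x : Fin d → ℤ) : walkTranslate d D α f x = f (x + α.toAdd) := by
  simp [walkTranslate, translate_apply]

theorem commute_step_fieldTranslate {d : ℕ} (α : Multiplicative (Fin d → ℤ)) :
    Commute (step d) (fieldTranslate d α) := by
  ext1 f
  funext x
  simp [step_apply, fieldTranslate_apply, sub_add_eq_add_sub]

theorem commute_lazyGrover_walkTranslate {d : ℕ} (α : Multiplicative (Fin d → ℤ)) :
    Commute (lazyGrover d) (walkTranslate d _ α) := by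
  ext1 f
  ext1
  funext x
  simp [coe_lazyGrover, walkTranslate_apply, step_apply, sub_add_eq_add_sub]

/-! ### Symbols and their actions -/

/-- The commutative ring of symbols, generated by the time shift and the space shifts. -/
abbrev WalkSymbol (d : ℕ) : Type := AddMonoidAlgebra ℂ (ℕ × (Fin d → ℤ))

/-- The evaluation of symbols at an operator commuting with a representation of `ℤᵈ`. -/
noncomputable def symbolHom {d : ℕ} {A : Type*} [Ring A] [Algebra ℂ A] (U : A)
    (τ : Multiplicative (Fin d → ℤ) →* A) (h : ∀ α, Commute U (τ α)) : WalkSymbol d →ₐ[ℂ] A :=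
  AddMonoidAlgebra.lift ℂ A (ℕ × (Fin d → ℤ))
    { toFun := fun g => U ^ g.toAdd.1 * τ (Multiplicative.ofAdd g.toAdd.2)
      map_one' := by simp
      map_mul' := fun a b => by
        simp only [toAdd_mul, Prod.fst_add, Prod.snd_add, pow_add, ofAdd_add, map_mul]
        rw [mul_assoc, mul_assoc, ← mul_assoc (U ^ b.toAdd.1),
          ((h _).pow_left b.toAdd.1).eq, mul_assoc] }

theorem symbolHom_single {d : ℕ} {A : Type*} [Ring A] [Algebra ℂ A] (U : A)
    (τ : Multiplicative (Fin d → ℤ) →* A) (h : ∀ α, Commute U (τ α)) (n : ℕ) (α : Fin d → ℤ)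
    (c : ℂ) : symbolHom U τ h (AddMonoidAlgebra.single (n, α) c) =
      c • (U ^ n * τ (Multiplicative.ofAdd α)) := by
  simp [symbolHom]

/-- Symbols acting on arbitrary functions. -/
noncomputable def fieldHom (d : ℕ) : WalkSymbol d →ₐ[ℂ] Module.End ℂ (StateField d) :=
  symbolHom (step d) (fieldTranslate d) commute_step_fieldTranslate

/-- Symbols acting on square-summable functions. -/
noncomputable def walkHom (d : ℕ) :
    WalkSymbol d →ₐ[ℂ] (WalkSpace d (2 * d + 1) →L[ℂ] WalkSpace d (2 * d + 1)) :=
  symbolHom (lazyGrover d) (walkTranslate d _) commute_lazyGrover_walkTranslate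

theorem fieldHom_single_apply {d : ℕ} (n : ℕ) (α : Fin d → ℤ) (c : ℂ) (f : StateField d)
    (x : Fin d → ℤ) : fieldHom d (AddMonoidAlgebra.single (n, α) c) f x =
      c • (step d ^ n) f (x + α) := by
  rw [fieldHom, symbolHom_single, ((commute_step_fieldTranslate _).pow_left n).eq]
  rfl

theorem coe_walkHom {d : ℕ} (k : WalkSymbol d) (f : WalkSpace d (2 * d + 1)) :
    ⇑(walkHom d k f) = fieldHom d k ⇑f := by
  induction k using AddMonoidAlgebra.induction_linear with
  | zero =>
    simp only [map_zero]
    rfl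
  | add a b ha hb =>
    simp only [map_add, LinearMap.add_apply, ← ha, ← hb]
    rfl
  | single g c =>
    obtain ⟨n, α⟩ := g
    funext x
    rw [fieldHom_single_apply, walkHom, symbolHom_single,
      ((commute_lazyGrover_walkTranslate _).pow_left n).eq, ← coe_lazyGrover_pow]
    simp [walkTranslate_apply]

/-- The time shift. -/
noncomputable def timeSymbol (d : ℕ) : WalkSymbol d := AddMonoidAlgebra.single (1, 0) 1

/-- The space shift by `α`. -/
noncomputable def spaceSymbol {d : ℕ} (α : Fin d → ℤ) : WalkSymbol d :=
  AddMonoidAlgebra.single (0, α) 1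

theorem spaceSymbol_mul {d : ℕ} (α β : Fin d → ℤ) :
    spaceSymbol α * spaceSymbol β = spaceSymbol (α + β) := by
  simp [spaceSymbol, AddMonoidAlgebra.single_mul_single]

theorem spaceSymbol_zero {d : ℕ} : spaceSymbol (0 : Fin d → ℤ) = 1 := rfl

theorem spaceSymbol_neg_mul {d : ℕ} (α : Fin d → ℤ) :
    spaceSymbol (-α) * spaceSymbol α = 1 := by
  rw [spaceSymbol_mul, neg_add_cancel, spaceSymbol_zero]

/-- The symbol `z_j + z_j⁻¹`. -/
noncomputable def cosSymbol {d : ℕ} (j : Fin d) : WalkSymbol d :=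
  spaceSymbol (-unitStep j) + spaceSymbol (unitStep j)

/-- The dispersion polynomial annihilating the walk. -/
noncomputable def dispSymbol (d : ℕ) : WalkSymbol d :=
  (timeSymbol d - 1) * reducedDisp (timeSymbol d) cosSymbol Finset.univ

/-! ### The dispersion relation -/

/-- The representation of the monoid algebra on functions on the monoid by translation. -/
noncomputable def regularHom (G E : Type*) [AddCommMonoid G] [AddCommGroup E] [Module ℂ E] :
    AddMonoidAlgebra ℂ G →ₐ[ℂ] Module.End ℂ (G → E) :=
  AddMonoidAlgebra.lift ℂ _ G
    { toFun := fun g =>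
        { toFun := fun u h => u (h + g.toAdd)
          map_add' := fun _ _ => rfl
          map_smul' := fun _ _ => rfl }
      map_one' := by
        ext1 u
        funext h
        simp
      map_mul' := fun a b => by
        ext1 u
        funext h
        simp [add_assoc] }

theorem regularHom_single_apply {G E : Type*} [AddCommMonoid G] [AddCommGroup E] [Module ℂ E]
    (g h : G) (c : ℂ) (u : G → E) :
    regularHom G E (AddMonoidAlgebra.single g c) u h = c • u (h + g) := by
  simp [regularHom]

/-- The index of the step `u_j`. -/
def posIdx {d : ℕ} (j : Fin d) : Fin (2 * d + 1) := ⟨j.val, by omega⟩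

/-- The index of the step `0`. -/
def zeroIdx (d : ℕ) : Fin (2 * d + 1) := ⟨d, by omega⟩

/-- The index of the step `-u_j`. -/
def negIdx {d : ℕ} (j : Fin d) : Fin (2 * d + 1) := ⟨d + 1 + j.val, by omega⟩

theorem lazyStep_posIdx {d : ℕ} (j : Fin d) : lazyStep (posIdx j) = unitStep j := by
  simp [lazyStep, posIdx]

theorem lazyStep_zeroIdx (d : ℕ) : lazyStep (zeroIdx d) = 0 := by
  simp [lazyStep, zeroIdx]

theorem lazyStep_negIdx {d : ℕ} (j : Fin d) : lazyStep (negIdx j) = -unitStep j := by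
  have h1 : ¬ d + 1 + j.val < d := by omega
  have h2 : ¬ d + 1 + j.val = d := by omega
  simp [lazyStep, negIdx, h1, h2]

theorem idx_cases {d : ℕ} (i : Fin (2 * d + 1)) :
    (∃ j, i = posIdx j) ∨ i = zeroIdx d ∨ ∃ j, i = negIdx j := by
  rcases lt_trichotomy i.val d with h | h | h
  · exact Or.inl ⟨⟨i.val, h⟩, rfl⟩
  · exact Or.inr (Or.inl (Fin.ext h))
  · refine Or.inr (Or.inr ⟨⟨i.val - (d + 1), by omega⟩, Fin.ext ?_⟩)
    simp only [negIdx]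
    omega

theorem sum_idx {d : ℕ} {M : Type*} [AddCommMonoid M] (g : Fin (2 * d + 1) → M) :
    ∑ i, g i = ∑ j, (g (posIdx j) + g (negIdx j)) + g (zeroIdx d) := by
  have h : 2 * d + 1 = d + 1 + d := by omega
  rw [← Equiv.sum_comp (finCongr h).symm g, Fin.sum_univ_add, Fin.sum_univ_castSucc,
    Finset.sum_add_distrib, add_right_comm]
  congr 3

/-- The space-time history of the `l`-th component of a function. -/
noncomputable def history {d : ℕ} (f : StateField d) (l : Fin (2 * d + 1)) :
    ℕ × (Fin d → ℤ) → ℂ := fun p => (step d ^ p.1) f p.2 l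

theorem regularHom_history {d : ℕ} (k : WalkSymbol d) (f : StateField d)
    (l : Fin (2 * d + 1)) (p : ℕ × (Fin d → ℤ)) :
    regularHom _ ℂ k (history f l) p = (fieldHom d k ((step d ^ p.1) f)) p.2 l := by
  induction k using AddMonoidAlgebra.induction_linear with
  | zero => simp
  | add a b ha hb => simp [ha, hb]
  | single g c =>
    obtain ⟨n, α⟩ := g
    obtain ⟨m, x⟩ := p
    rw [regularHom_single_apply, fieldHom_single_apply, ← Module.End.mul_apply, ← pow_add,
      add_comm n m]
    rfl

/-- The walk mixes components, but on space-time histories the time shift acts on each component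
separately. The elimination lemmas then apply to scalar arrays as a module over the symbols. -/
theorem regularHom_disp_history {d : ℕ} (f : StateField d) (l : Fin (2 * d + 1)) :
    regularHom _ ℂ (dispSymbol d) (history f l) = 0 := by
  let _ : Module (WalkSymbol d) (ℕ × (Fin d → ℤ) → ℂ) :=
    Module.compHom _ (regularHom (ℕ × (Fin d → ℤ)) ℂ).toRingHom
  have smul_def : ∀ (k : WalkSymbol d) (u : ℕ × (Fin d → ℤ) → ℂ),
      k • u = regularHom _ ℂ k u := fun _ _ => rfl
  set σ : ℕ × (Fin d → ℤ) → ℂ := fun p => 2 / (2 * d + 1 : ℂ) * ∑ l, history f l p with hσ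
  set e : Fin (2 * d + 1) → ℕ × (Fin d → ℤ) → ℂ := fun l p => 2 * history f l p - σ p with he
  have hrel : ∀ l, (timeSymbol d + spaceSymbol (-lazyStep l)) • e l +
      (timeSymbol d - spaceSymbol (-lazyStep l)) • σ = 0 := by
    intro l
    simp only [smul_def]
    funext ⟨n, x⟩
    have hT : ∀ u : ℕ × (Fin d → ℤ) → ℂ, regularHom _ ℂ (timeSymbol d) u (n, x) =
        u (n + 1, x) := fun u => by
      rw [timeSymbol, regularHom_single_apply]; simp
    have hz : ∀ (α : Fin d → ℤ) (u : ℕ × (Fin d → ℤ) → ℂ),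
        regularHom _ ℂ (spaceSymbol α) u (n, x) = u (n, x + α) := fun α u => by
      rw [spaceSymbol, regularHom_single_apply]; simp
    have hstep : history f l (n + 1, x) =
        σ (n, x - lazyStep l) - history f l (n, x - lazyStep l) := by
      simp only [history, hσ, pow_succ', Module.End.mul_apply, step_apply_apply]
    simp only [map_add, map_sub, LinearMap.add_apply, LinearMap.sub_apply, Pi.add_apply,
      Pi.sub_apply, hT, hz, Pi.zero_apply, ← sub_eq_add_neg, he, hstep]
    ring
  have hsum : ∑ j, (e (posIdx j) + e (negIdx j)) + e (zeroIdx d) = 0 := by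
    rw [← sum_idx e]
    funext p
    have hd : (2 * d + 1 : ℂ) ≠ 0 := by exact_mod_cast (Nat.succ_ne_zero (2 * d))
    rw [Finset.sum_apply]
    simp only [he, Finset.sum_sub_distrib, ← Finset.mul_sum, Finset.sum_const, hσ]
    simp
    field_simp
    ring
  have hp : ∀ j : Fin d, _ := fun j => hrel (posIdx j)
  have hn : ∀ j : Fin d, _ := fun j => hrel (negIdx j)
  have h₀ := hrel (zeroIdx d)
  simp only [lazyStep_posIdx] at hp
  simp only [lazyStep_negIdx, neg_neg] at hn
  rw [lazyStep_zeroIdx, neg_zero, spaceSymbol_zero] at h₀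
  have hz : ∀ j : Fin d, spaceSymbol (-unitStep j) * spaceSymbol (unitStep j) = 1 :=
    fun j => spaceSymbol_neg_mul _
  -- The elimination lemma treats only the first member of each pair; the steps `-u_j` follow by
  -- exchanging the two families.
  have hz' : ∀ j : Fin d, spaceSymbol (unitStep j) * spaceSymbol (-unitStep j) = 1 :=
    fun j => by rw [mul_comm, hz]
  have hcos : (fun j : Fin d => spaceSymbol (unitStep j) + spaceSymbol (-unitStep j)) =
      cosSymbol := funext fun j => add_comm _ _
  obtain ⟨hσ0, he0⟩ := disp_smul_center hz hp hn h₀ hsum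
  have hel : dispSymbol d • e l = 0 := by
    rcases idx_cases l with ⟨j, rfl⟩ | rfl | ⟨j, rfl⟩
    · exact disp_smul_side hz hp hn h₀ hsum j
    · exact he0
    · have := disp_smul_side hz' hn hp h₀ (by simpa only [add_comm] using hsum) j
      rwa [hcos] at this
  have hl : history f l = (1 / 2 : ℂ) • (e l + σ) := by
    funext p
    simp [he]
  rw [hl, map_smul, map_add, ← smul_def, ← smul_def, hel]
  erw [hσ0]
  simp

theorem fieldHom_dispSymbol (d : ℕ) : fieldHom d (dispSymbol d) = 0 := by
  ext1 f
  funext x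
  ext l
  have := regularHom_history (dispSymbol d) f l (0, x)
  rw [regularHom_disp_history] at this
  exact this.symm

theorem walkHom_dispSymbol (d : ℕ) : walkHom d (dispSymbol d) = 0 := by
  ext1 f
  ext1
  rw [coe_walkHom, fieldHom_dispSymbol]
  rfl

/-! ### Position, two time directions and the velocity symbol -/

/-- Multiplication by the `j`-th coordinate. -/
noncomputable def position {d : ℕ} (j : Fin d) : Module.End ℂ (StateField d) where
  toFun f x := (x j : ℂ) • f x
  map_add' f g := by
    ext1 x
    simp
  map_smul' c f := by
    ext1 x
    simp [smul_smul, mul_comm]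

/-- The monoid of two time directions and the space directions. -/
abbrev DoubleTime (d : ℕ) : Type := ℕ × ℕ × (Fin d → ℤ)

/-- The array `(m, n, x) ↦ (Uᵐ X Uⁿ f)(x)`, where `X` is multiplication by a coordinate. -/
noncomputable def positionArray {d : ℕ} (j : Fin d) :
    StateField d →ₗ[ℂ] (DoubleTime d → EuclideanSpace ℂ (Fin (2 * d + 1))) where
  toFun f p := (step d ^ p.1) (position j ((step d ^ p.2.1) f)) p.2.2
  map_add' f g := by
    funext p
    simp
  map_smul' c f := by
    funext p
    simp

theorem positionArray_apply {d : ℕ} (j : Fin d) (f : StateField d) (m n : ℕ) (x : Fin d → ℤ) :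
    positionArray j f (m, n, x) = (step d ^ m) (position j ((step d ^ n) f)) x := rfl

/-- The array `(m, n, x) ↦ (Uᵐ⁺ⁿ f)(x)`. -/
noncomputable def timeArray {d : ℕ} (f : StateField d) :
    DoubleTime d → EuclideanSpace ℂ (Fin (2 * d + 1)) :=
  fun p => (step d ^ (p.1 + p.2.1)) f p.2.2

/-- Symbols acting in the first time direction. -/
noncomputable def leftSymbol (d : ℕ) : WalkSymbol d →ₐ[ℂ] AddMonoidAlgebra ℂ (DoubleTime d) :=
  AddMonoidAlgebra.mapDomainAlgHom ℂ ℂ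
    { toFun := fun p : ℕ × (Fin d → ℤ) => ((p.1, 0, p.2) : DoubleTime d)
      map_zero' := rfl
      map_add' := fun _ _ => rfl }

/-- Symbols acting in the second time direction. -/
noncomputable def rightSymbol (d : ℕ) : WalkSymbol d →ₐ[ℂ] AddMonoidAlgebra ℂ (DoubleTime d) :=
  AddMonoidAlgebra.mapDomainAlgHom ℂ ℂ
    { toFun := fun p : ℕ × (Fin d → ℤ) => ((0, p.1, p.2) : DoubleTime d)
      map_zero' := rfl
      map_add' := fun _ _ => rfl }

theorem leftSymbol_single {d : ℕ} (n : ℕ) (α : Fin d → ℤ) (c : ℂ) :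
    leftSymbol d (AddMonoidAlgebra.single (n, α) c) = AddMonoidAlgebra.single (n, 0, α) c := by
  simp [leftSymbol]

theorem rightSymbol_single {d : ℕ} (n : ℕ) (α : Fin d → ℤ) (c : ℂ) :
    rightSymbol d (AddMonoidAlgebra.single (n, α) c) = AddMonoidAlgebra.single (0, n, α) c := by
  simp [rightSymbol]

/-- Both images have the same spatial part, so this is the divisibility of `P(b) - P(a)` by `b - a`
for a polynomial `P`. The quotient is the array operator that drives the telescoping. -/
theorem sub_dvd_rightSymbol_sub_leftSymbol {d : ℕ} (k : WalkSymbol d) :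
    (AddMonoidAlgebra.single (0, 1, 0) 1 - AddMonoidAlgebra.single (1, 0, 0) 1 :
      AddMonoidAlgebra ℂ (DoubleTime d)) ∣ rightSymbol d k - leftSymbol d k := by
  induction k using AddMonoidAlgebra.induction_linear with
  | zero => simp
  | add a b ha hb =>
    rw [map_add, map_add, add_sub_add_comm]
    exact dvd_add ha hb
  | single g c =>
    obtain ⟨n, α⟩ := g
    have h : rightSymbol d (AddMonoidAlgebra.single (n, α) c) -
        leftSymbol d (AddMonoidAlgebra.single (n, α) c) =
        (AddMonoidAlgebra.single (0, 1, 0) 1 ^ n - AddMonoidAlgebra.single (1, 0, 0) 1 ^ n) *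
          (AddMonoidAlgebra.single (0, 0, α) c : AddMonoidAlgebra ℂ (DoubleTime d)) := by
      rw [leftSymbol_single, rightSymbol_single, sub_mul, AddMonoidAlgebra.single_pow,
        AddMonoidAlgebra.single_pow, AddMonoidAlgebra.single_mul_single,
        AddMonoidAlgebra.single_mul_single]
      simp
    rw [h]
    exact Dvd.dvd.mul_right (sub_dvd_pow_sub_pow _ _ n) _

theorem commute_step_fieldHom {d : ℕ} (k : WalkSymbol d) : Commute (step d) (fieldHom d k) := by
  have : step d = fieldHom d (timeSymbol d) := by
    rw [timeSymbol, fieldHom, symbolHom_single]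
    simp [← Prod.fst_zero]
  rw [this]
  exact (Commute.all _ k).map (fieldHom d)

theorem regularHom_leftSymbol_positionArray {d : ℕ} (j : Fin d) (k : WalkSymbol d)
    (f : StateField d) (m n : ℕ) (x : Fin d → ℤ) :
    regularHom _ _ (leftSymbol d k) (positionArray j f) (m, n, x) =
      fieldHom d k ((step d ^ m) (position j ((step d ^ n) f))) x := by
  induction k using AddMonoidAlgebra.induction_linear with
  | zero => simp
  | add a b ha hb => simp [ha, hb]
  | single g c =>
    obtain ⟨l, α⟩ := g
    rw [leftSymbol_single, regularHom_single_apply, fieldHom_single_apply,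
      ← Module.End.mul_apply (step d ^ l), ← pow_add, add_comm l m]
    rfl

theorem regularHom_rightSymbol_timeArray {d : ℕ} (k : WalkSymbol d) (f : StateField d) :
    regularHom _ _ (rightSymbol d k) (timeArray f) = timeArray (fieldHom d k f) := by
  induction k using AddMonoidAlgebra.induction_linear with
  | zero =>
    funext p
    simp [timeArray]
  | add a b ha hb =>
    rw [map_add, map_add, LinearMap.add_apply, ha, hb]
    funext p
    simp [timeArray]
  | single g c =>
    obtain ⟨l, α⟩ := g
    funext ⟨m, n, x⟩
    have h := (commute_step_fieldHom (AddMonoidAlgebra.single (l, α) c)).pow_left (m + n)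
    have h' := congrFun (LinearMap.congr_fun h.eq f) x
    simp only [Module.End.mul_apply] at h'
    rw [rightSymbol_single, regularHom_single_apply]
    simp only [timeArray]
    rw [h', fieldHom_single_apply, ← Module.End.mul_apply (step d ^ l), ← pow_add,
      add_comm l, Prod.mk_add_mk, Prod.mk_add_mk, add_zero, add_assoc m n l]

theorem position_translate {d : ℕ} (j : Fin d) (α : Fin d → ℤ) (f : StateField d)
    (x : Fin d → ℤ) :
    position j f (x + α) = position j (fieldTranslate d (Multiplicative.ofAdd α) f) x +
      (α j : ℂ) • f (x + α) := by
  simp [position, fieldTranslate_apply, add_smul]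

/-- The right action translates after `X` has been applied; moving the translation past `X` costs
the commutator `α_j τ`. -/
theorem regularHom_rightSymbol_single_positionArray {d : ℕ} (j : Fin d) (l : ℕ)
    (α : Fin d → ℤ) (f : StateField d) :
    regularHom _ _ (rightSymbol d (AddMonoidAlgebra.single (l, α) 1)) (positionArray j f) =
      positionArray j (fieldHom d (AddMonoidAlgebra.single (l, α) 1) f) +
        (α j : ℂ) • timeArray (fieldHom d (AddMonoidAlgebra.single (l, α) 1) f) := by
  funext ⟨m, n, x⟩
  have hk : fieldHom d (AddMonoidAlgebra.single (l, α) 1) =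
      fieldTranslate d (Multiplicative.ofAdd α) * step d ^ l := by
    rw [fieldHom, symbolHom_single, one_smul,
      ((commute_step_fieldTranslate _).pow_left l).eq]
  set τ := fieldTranslate d (Multiplicative.ofAdd α) with hτ
  have hc : ∀ i, Commute (step d ^ i) τ := fun i => (commute_step_fieldTranslate _).pow_left i
  have hX : ∀ g : StateField d, τ (position j g) = position j (τ g) + (α j : ℂ) • τ g := by
    intro g
    funext y
    exact position_translate j α g y
  have h1 : ∀ i g, (step d ^ i) (τ g) = τ ((step d ^ i) g) :=
    fun i g => LinearMap.congr_fun (hc i).eq g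
  rw [rightSymbol_single, regularHom_single_apply, hk, one_smul, Module.End.mul_apply]
  simp only [Pi.add_apply, Pi.smul_apply, timeArray, Prod.mk_add_mk, add_zero,
    positionArray_apply, pow_add, Module.End.mul_apply, h1]
  have h2 := congrFun (h1 m (position j ((step d ^ n) ((step d ^ l) f)))) x
  rw [hX, map_add, map_smul, h1] at h2
  exact h2.symm

/-- The symbols whose action in the second time direction commutes with the `j`-th position. -/
noncomputable def positionCommuting {d : ℕ} (j : Fin d) : Subalgebra ℂ (WalkSymbol d) where
  carrier := {k | ∀ f, regularHom _ _ (rightSymbol d k) (positionArray j f) =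
    positionArray j (fieldHom d k f)}
  mul_mem' {a b} ha hb f := by
    rw [map_mul, map_mul, map_mul, Module.End.mul_apply, hb, ha]
    rfl
  add_mem' {a b} ha hb f := by
    rw [map_add, map_add, map_add, LinearMap.add_apply, ha, hb, LinearMap.add_apply, map_add]
  algebraMap_mem' c f := by
    simp [Algebra.algebraMap_eq_smul_one]

theorem mem_positionCommuting {d : ℕ} {j : Fin d} {k : WalkSymbol d} :
    k ∈ positionCommuting j ↔ ∀ f, regularHom _ _ (rightSymbol d k) (positionArray j f) =
      positionArray j (fieldHom d k f) := Iff.rfl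

theorem single_mem_positionCommuting {d : ℕ} {j : Fin d} (l : ℕ) {α : Fin d → ℤ}
    (hα : α j = 0) : AddMonoidAlgebra.single (l, α) 1 ∈ positionCommuting j := by
  intro f
  rw [regularHom_rightSymbol_single_positionArray, hα]
  simp

theorem timeSymbol_mem_positionCommuting {d : ℕ} (j : Fin d) :
    timeSymbol d ∈ positionCommuting j := single_mem_positionCommuting 1 rfl

theorem dispFactor_mem_positionCommuting {d : ℕ} {j l : Fin d} (h : l ≠ j) :
    dispFactor (timeSymbol d) cosSymbol l ∈ positionCommuting j := by
  have hT := timeSymbol_mem_positionCommuting j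
  refine add_mem (add_mem (pow_mem hT 2) (one_mem _)) (mul_mem hT (add_mem ?_ ?_)) <;>
    exact single_mem_positionCommuting 0 (by simp [unitStep, h.symm])

theorem prod_dispFactor_mem_positionCommuting {d : ℕ} {j : Fin d} {s : Finset (Fin d)}
    (h : j ∉ s) :
    ∏ l ∈ s, dispFactor (timeSymbol d) cosSymbol l ∈ positionCommuting j :=
  prod_mem fun _ hl => dispFactor_mem_positionCommuting fun hlj => h (hlj ▸ hl)

theorem reducedDisp_mem_positionCommuting {d : ℕ} {j : Fin d} {s : Finset (Fin d)}
    (h : j ∉ s) : reducedDisp (timeSymbol d) cosSymbol s ∈ positionCommuting j := by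
  have hT := timeSymbol_mem_positionCommuting j
  have h2 : (2 : WalkSymbol d) ∈ positionCommuting j := by
    rw [← one_add_one_eq_two]
    exact add_mem (one_mem _) (one_mem _)
  exact add_mem (prod_dispFactor_mem_positionCommuting h)
    (mul_mem (mul_mem h2 (pow_mem (add_mem hT (one_mem _)) 2))
      (sum_mem fun i _ => prod_dispFactor_mem_positionCommuting
        fun hj => h (Finset.mem_of_mem_erase hj)))

/-- The derivative of the dispersion polynomial in the `j`-th quasi-momentum. -/
noncomputable def velocitySymbol {d : ℕ} (j : Fin d) : WalkSymbol d :=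
  (timeSymbol d - 1) * reducedDisp (timeSymbol d) cosSymbol (Finset.univ.erase j) *
    timeSymbol d * (spaceSymbol (unitStep j) - spaceSymbol (-unitStep j))

theorem regularHom_rightSymbol_cosSymbol {d : ℕ} (j : Fin d) (f : StateField d) :
    regularHom _ _ (rightSymbol d (cosSymbol j)) (positionArray j f) =
      positionArray j (fieldHom d (cosSymbol j) f) +
        timeArray (fieldHom d (spaceSymbol (unitStep j) - spaceSymbol (-unitStep j)) f) := by
  have h : ∀ f g : StateField d, timeArray (f - g) = timeArray f - timeArray g := fun f g => by
    funext p
    simp [timeArray]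
  simp only [cosSymbol, spaceSymbol, map_add, LinearMap.add_apply, map_sub, LinearMap.sub_apply,
    regularHom_rightSymbol_single_positionArray, h, Pi.neg_apply, unitStep_apply_self]
  push_cast
  module

/-- The polynomial `p` is affine in `t_j`, as `p = a t_j + b` with `a` and `b` free of shifts in
direction `j`. Only `t_j` fails to commute with `X`, so the terms with `X` recombine into `p(U) f =
0` and the commutator term is left. -/
theorem regularHom_rightSymbol_dispSymbol {d : ℕ} (j : Fin d) (f : StateField d) :
    regularHom _ _ (rightSymbol d (dispSymbol d)) (positionArray j f) =
      timeArray (fieldHom d (velocitySymbol j) f) := by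
  have hj := Finset.notMem_erase j Finset.univ
  set T := timeSymbol d with hTdef
  set A := reducedDisp T cosSymbol (Finset.univ.erase j) with hA
  have hT := timeSymbol_mem_positionCommuting j
  have h1 := one_mem (positionCommuting j)
  have hb : (T - 1) * (A * (T ^ 2 + 1) + 2 * (T + 1) ^ 2 *
      ∏ l ∈ Finset.univ.erase j, dispFactor T cosSymbol l) ∈ positionCommuting j := by
    have h2 : (2 : WalkSymbol d) ∈ positionCommuting j := by
      rw [← one_add_one_eq_two]
      exact add_mem h1 h1
    exact mul_mem (sub_mem hT h1) (add_mem
      (mul_mem (reducedDisp_mem_positionCommuting hj) (add_mem (pow_mem hT 2) h1))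
      (mul_mem (mul_mem h2 (pow_mem (add_mem hT h1) 2))
        (prod_dispFactor_mem_positionCommuting hj)))
  have ha : (T - 1) * A * T ∈ positionCommuting j :=
    mul_mem (mul_mem (sub_mem hT h1) (reducedDisp_mem_positionCommuting hj)) hT
  have hdisp : dispSymbol d = (T - 1) * (A * (T ^ 2 + 1) + 2 * (T + 1) ^ 2 *
      ∏ l ∈ Finset.univ.erase j, dispFactor T cosSymbol l) + (T - 1) * A * T * cosSymbol j := by
    have h := reducedDisp_insert T cosSymbol hj
    rw [Finset.insert_erase (Finset.mem_univ j), ← hA] at h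
    rw [dispSymbol, h, show dispFactor T cosSymbol j = T ^ 2 + 1 + T * cosSymbol j from rfl]
    ring
  set a := (T - 1) * A * T
  set b := (T - 1) * (A * (T ^ 2 + 1) + 2 * (T + 1) ^ 2 *
      ∏ l ∈ Finset.univ.erase j, dispFactor T cosSymbol l)
  have hv : velocitySymbol j = a * (spaceSymbol (unitStep j) - spaceSymbol (-unitStep j)) := rfl
  have h0 : fieldHom d b f + fieldHom d (a * cosSymbol j) f = 0 := by
    rw [← LinearMap.add_apply, ← map_add, ← hdisp, fieldHom_dispSymbol]
    rfl
  clear_value a b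
  rw [hdisp, hv, map_add, map_add, LinearMap.add_apply, mem_positionCommuting.1 hb, map_mul,
    map_mul, Module.End.mul_apply, regularHom_rightSymbol_cosSymbol, map_add,
    mem_positionCommuting.1 ha, regularHom_rightSymbol_timeArray, ← Module.End.mul_apply,
    ← map_mul, ← Module.End.mul_apply, ← map_mul, ← add_assoc, ← map_add, h0]
  simp

/-! ### Boundedness and the decay rate `1/n` -/

/-- Arrays which are pointwise bounded along both time directions. -/
def axisBounded (d : ℕ) (E : Type*) [NormedAddCommGroup E] [NormedSpace ℂ E] :
    Submodule ℂ (DoubleTime d → E) where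
  carrier := {u | (∀ m x, ∃ C, ∀ n, ‖u (m, n, x)‖ ≤ C) ∧ ∀ n x, ∃ C, ∀ m, ‖u (m, n, x)‖ ≤ C}
  zero_mem' := ⟨fun _ _ => ⟨0, by simp⟩, fun _ _ => ⟨0, by simp⟩⟩
  add_mem' {u v} hu hv := by
    constructor
    · intro m x
      obtain ⟨C, hC⟩ := hu.1 m x
      obtain ⟨C', hC'⟩ := hv.1 m x
      exact ⟨C + C', fun n => (norm_add_le _ _).trans (add_le_add (hC n) (hC' n))⟩
    · intro n x
      obtain ⟨C, hC⟩ := hu.2 n x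
      obtain ⟨C', hC'⟩ := hv.2 n x
      exact ⟨C + C', fun m => (norm_add_le _ _).trans (add_le_add (hC m) (hC' m))⟩
  smul_mem' c u hu := by
    constructor
    · intro m x
      obtain ⟨C, hC⟩ := hu.1 m x
      exact ⟨‖c‖ * C, fun n => (norm_smul_le _ _).trans
        (mul_le_mul_of_nonneg_left (hC n) (norm_nonneg c))⟩
    · intro n x
      obtain ⟨C, hC⟩ := hu.2 n x
      exact ⟨‖c‖ * C, fun m => (norm_smul_le _ _).trans
        (mul_le_mul_of_nonneg_left (hC m) (norm_nonneg c))⟩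

theorem regularHom_mem_axisBounded {d : ℕ} {E : Type*} [NormedAddCommGroup E] [NormedSpace ℂ E]
    (k : AddMonoidAlgebra ℂ (DoubleTime d)) {u : DoubleTime d → E} (hu : u ∈ axisBounded d E) :
    regularHom _ _ k u ∈ axisBounded d E := by
  induction k using AddMonoidAlgebra.induction_linear with
  | zero => simp
  | add a b ha hb =>
    rw [map_add]
    exact add_mem ha hb
  | single g c =>
    obtain ⟨l, l', α⟩ := g
    have h : regularHom _ _ (AddMonoidAlgebra.single (l, l', α) c) u =
        c • fun p => u (p + (l, l', α)) := by
      funext p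
      rw [regularHom_single_apply]
      rfl
    rw [h]
    refine Submodule.smul_mem _ _ ⟨fun m x => ?_, fun n x => ?_⟩
    · obtain ⟨C, hC⟩ := hu.1 (m + l) (x + α)
      exact ⟨C, fun n => hC (n + l')⟩
    · obtain ⟨C, hC⟩ := hu.2 (n + l') (x + α)
      exact ⟨C, fun m => hC (m + l)⟩

/-- One step reads only finitely many sites, so bounds that depend on the site survive any fixed
number of steps. -/
theorem step_pow_bounded {d : ℕ} {h : ℕ → StateField d} (hh : ∀ x, ∃ C, ∀ n, ‖h n x‖ ≤ C)
    (m : ℕ) : ∀ x, ∃ C, ∀ n, ‖(step d ^ m) (h n) x‖ ≤ C := by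
  induction m with
  | zero => simpa using hh
  | succ m ih =>
    intro x
    choose C hC using ih
    refine ⟨∑ i, ‖coinPart i‖ * C (x - lazyStep i), fun n => ?_⟩
    rw [pow_succ', Module.End.mul_apply, step_apply]
    exact (norm_sum_le _ _).trans (Finset.sum_le_sum fun i _ =>
      ((coinPart i).le_opNorm _).trans
        (mul_le_mul_of_nonneg_left (hC _ n) (norm_nonneg _)))

theorem finite_support_step {d : ℕ} {f : StateField d} (hf : (Function.support f).Finite) :
    (Function.support (step d f)).Finite := by
  refine (Set.finite_iUnion fun i : Fin (2 * d + 1) => hf.image (· + lazyStep i)).subset ?_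
  intro x hx
  by_contra h
  refine hx ?_
  rw [step_apply]
  refine Finset.sum_eq_zero fun i _ => ?_
  have : f (x - lazyStep i) = 0 := by
    by_contra h0
    exact h (Set.mem_iUnion.2 ⟨i, x - lazyStep i, h0, by simp⟩)
  rw [this, map_zero]

theorem finite_support_step_pow {d : ℕ} {f : StateField d} (hf : (Function.support f).Finite)
    (n : ℕ) : (Function.support ((step d ^ n) f)).Finite := by
  induction n with
  | zero => exact hf
  | succ n ih =>
    rw [pow_succ', Module.End.mul_apply]
    exact finite_support_step ih

theorem memlp_of_finite_support {d D : ℕ} {f : (Fin d → ℤ) → EuclideanSpace ℂ (Fin D)}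
    (hf : (Function.support f).Finite) : Memℓp f 2 := by
  refine (memℓp_gen_iff (p := 2) (by norm_num)).2 (summable_of_hasFiniteSupport (hf.subset ?_))
  intro x hx h0
  exact hx (by simp [h0])

theorem norm_lazyGrover_pow_apply {d : ℕ}
    (hU : ∀ f, ‖lazyGrover d f‖ = ‖f‖) (n : ℕ) (f : WalkSpace d (2 * d + 1)) :
    ‖(lazyGrover d ^ n) f‖ = ‖f‖ := by
  induction n with
  | zero => rfl
  | succ n ih => rw [pow_succ', mul_apply_eq_comp, hU, ih]

/-- For fixed `m`, the values of `X Uⁿ f` at a site `x` are bounded by `|x_j| ‖f‖`, and `Uᵐ` is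
local. For fixed `n`, the function `X Uⁿ f` has finite support, hence is square-summable, and `Uᵐ`
preserves its norm. -/
theorem positionArray_mem_axisBounded {d : ℕ} (hU : ∀ f, ‖lazyGrover d f‖ = ‖f‖) (j : Fin d)
    (f : WalkSpace d (2 * d + 1)) (hf : (Function.support ⇑f).Finite) :
    positionArray j ⇑f ∈ axisBounded d (EuclideanSpace ℂ (Fin (2 * d + 1))) := by
  constructor
  · intro m
    refine step_pow_bounded (h := fun n => position j ((step d ^ n) ⇑f)) (fun x => ?_) m
    refine ⟨‖(x j : ℂ)‖ * ‖f‖, fun n => (norm_smul_le _ _).trans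
      (mul_le_mul_of_nonneg_left ?_ (norm_nonneg _))⟩
    rw [← coe_lazyGrover_pow, ← norm_lazyGrover_pow_apply hU n f]
    exact lp.norm_apply_le_norm (by norm_num) _ x
  · intro n x
    have hs : (Function.support (position j ((step d ^ n) ⇑f))).Finite := by
      refine (finite_support_step_pow hf n).subset fun y hy h0 => hy ?_
      simp only [position, LinearMap.coe_mk, AddHom.coe_mk, h0, smul_zero]
    let g : WalkSpace d (2 * d + 1) := ⟨_, memlp_of_finite_support hs⟩
    refine ⟨‖g‖, fun m => ?_⟩
    have h : positionArray j ⇑f (m, n, x) = (lazyGrover d ^ m) g x := by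
      rw [coe_lazyGrover_pow]
      rfl
    rw [h, ← norm_lazyGrover_pow_apply hU m g]
    exact lp.norm_apply_le_norm (by norm_num) _ x

theorem tendsto_lazyGrover_pow_velocity {d : ℕ} (hU : ∀ f, ‖lazyGrover d f‖ = ‖f‖) (j : Fin d)
    (f : WalkSpace d (2 * d + 1)) (hf : (Function.support ⇑f).Finite) (x : Fin d → ℤ) :
    Filter.Tendsto (fun n : ℕ => (lazyGrover d ^ n) (walkHom d (velocitySymbol j) f) x)
      Filter.atTop (nhds 0) := by
  obtain ⟨q, hq⟩ := sub_dvd_rightSymbol_sub_leftSymbol (dispSymbol d)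
  set u := regularHom _ _ q (positionArray j ⇑f) with hu
  have hub : u ∈ axisBounded d _ :=
    regularHom_mem_axisBounded q (positionArray_mem_axisBounded hU j f hf)
  set g : ℕ → EuclideanSpace ℂ (Fin (2 * d + 1)) :=
    fun n => (lazyGrover d ^ n) (walkHom d (velocitySymbol j) f) x with hg
  have hrec : ∀ m n, u (m, n + 1, x) - u (m + 1, n, x) = g (m + n) := by
    intro m n
    have h1 : regularHom _ _ (rightSymbol d (dispSymbol d) - leftSymbol d (dispSymbol d))
        (positionArray j ⇑f) (m, n, x) = g (m + n) := by
      rw [map_sub, LinearMap.sub_apply, Pi.sub_apply, regularHom_leftSymbol_positionArray,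
        fieldHom_dispSymbol, regularHom_rightSymbol_dispSymbol, ← coe_walkHom]
      simp only [hg, timeArray, coe_lazyGrover_pow, LinearMap.zero_apply, Pi.zero_apply, sub_zero]
    rw [← h1, hq, map_mul, Module.End.mul_apply, ← hu, map_sub, LinearMap.sub_apply,
      Pi.sub_apply, regularHom_single_apply, regularHom_single_apply]
    simp
  -- The increments of `u` along an antidiagonal all equal the same `g (m + n)`, so they add up
  -- instead of cancelling.
  have htel : ∀ n m, u (m, n + 1, x) - u (m + n + 1, 0, x) = ((n + 1 : ℕ) : ℂ) • g (m + n) := by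
    intro n
    induction n with
    | zero =>
      intro m
      simpa using hrec m 0
    | succ n ih =>
      intro m
      have h1 := hrec m (n + 1)
      have h2 := ih (m + 1)
      rw [show m + 1 + n = m + (n + 1) by omega] at h2
      rw [← sub_add_sub_cancel, h1, h2]
      push_cast
      module
  -- For `m = 0` the antidiagonal ends on the two axes, the only places where uniform bounds are
  -- available.
  obtain ⟨C, hC⟩ := hub.1 0 x
  obtain ⟨C', hC'⟩ := hub.2 0 x
  have hbound : ∀ n : ℕ, ‖g n‖ ≤ (C + C') * (1 / ((n : ℝ) + 1)) := by
    intro n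
    have h1 : ‖((n + 1 : ℕ) : ℂ) • g n‖ ≤ C + C' := by
      have h2 := htel n 0
      rw [zero_add] at h2
      rw [← h2]
      exact (norm_sub_le _ _).trans (add_le_add (hC _) (hC' _))
    rw [norm_smul, Complex.norm_natCast] at h1
    push_cast at h1
    rw [mul_one_div, le_div_iff₀ (by positivity), mul_comm]
    exact h1
  refine squeeze_zero_norm hbound ?_
  simpa using tendsto_one_div_add_atTop_nhds_zero_nat.const_mul (C + C')

/-! ### Unitarity of the walk and normality of the symbols -/

theorem adjoint_translate {d D : ℕ} (α : Fin d → ℤ) :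
    star (translate α : WalkSpace d D →L[ℂ] WalkSpace d D) = translate (-α) := by
  symm
  rw [ContinuousLinearMap.star_eq_adjoint, ContinuousLinearMap.eq_adjoint_iff]
  intro f g
  rw [lp.inner_eq_tsum, lp.inner_eq_tsum, ← (Equiv.subRight α).tsum_eq]
  simp [translate_apply]

theorem adjoint_fiberwise {d D : ℕ}
    (A : EuclideanSpace ℂ (Fin D) →L[ℂ] EuclideanSpace ℂ (Fin D)) :
    star (fiberwise A : WalkSpace d D →L[ℂ] WalkSpace d D) = fiberwise (star A) := by
  symm
  rw [ContinuousLinearMap.star_eq_adjoint (fiberwise A), ContinuousLinearMap.eq_adjoint_iff]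
  intro f g
  rw [lp.inner_eq_tsum, lp.inner_eq_tsum]
  simp only [fiberwise_apply, ContinuousLinearMap.star_eq_adjoint,
    ContinuousLinearMap.adjoint_inner_left]

theorem translate_mul {d D : ℕ} (α β : Fin d → ℤ) :
    (translate α * translate β : WalkSpace d D →L[ℂ] WalkSpace d D) = translate (α + β) := by
  ext1 f
  ext1
  funext x
  simp [translate_apply, sub_sub]

theorem translate_zero {d D : ℕ} :
    (translate 0 : WalkSpace d D →L[ℂ] WalkSpace d D) = 1 := by
  ext1 f
  ext1
  funext x
  simp [translate_apply]

theorem fiberwise_mul {d D : ℕ} (A B : EuclideanSpace ℂ (Fin D) →L[ℂ] EuclideanSpace ℂ (Fin D)) :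
    (fiberwise A * fiberwise B : WalkSpace d D →L[ℂ] WalkSpace d D) = fiberwise (A * B) := rfl

theorem fiberwise_one {d D : ℕ} :
    (fiberwise 1 : WalkSpace d D →L[ℂ] WalkSpace d D) = 1 := rfl

theorem translate_mul_fiberwise {d D : ℕ} (α : Fin d → ℤ)
    (A : EuclideanSpace ℂ (Fin D) →L[ℂ] EuclideanSpace ℂ (Fin D)) :
    (translate α * fiberwise A : WalkSpace d D →L[ℂ] WalkSpace d D) =
      fiberwise A * translate α := by
  ext1 f
  ext1
  funext x
  rw [mul_apply_eq_comp, mul_apply_eq_comp, translate_apply, fiberwise_apply, fiberwise_apply,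
    translate_apply]

theorem coordProj_mul {D : ℕ} (i j : Fin D) :
    coordProj i * coordProj j = if i = j then coordProj i else 0 := by
  ext v k
  rw [mul_apply_eq_comp, coordProj_apply, coordProj_apply]
  split_ifs with h
  · subst h
    simp [coordProj_apply]
  · simp [h]

theorem sum_coordProj (D : ℕ) : ∑ i : Fin D, coordProj i = 1 := by
  ext v k
  rw [sum_apply, WithLp.ofLp_sum, Finset.sum_apply]
  simp [coordProj_apply]

theorem star_coordProj {D : ℕ} (i : Fin D) : star (coordProj i) = coordProj i :=
  isSelfAdjoint_starProjection _

theorem sum_fiberwise_coordProj (d D : ℕ) :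
    ∑ i : Fin D, (fiberwise (coordProj i) : WalkSpace d D →L[ℂ] WalkSpace d D) = 1 := by
  ext1 f
  ext1
  funext x
  rw [sum_apply, coe_sum]
  simp only [fiberwise_apply]
  rw [← sum_apply, sum_coordProj]
  rfl

theorem fiberwise_zero {d D : ℕ} :
    (fiberwise 0 : WalkSpace d D →L[ℂ] WalkSpace d D) = 0 := by
  ext1 f
  ext1
  rfl

theorem shift_mem_unitary (d : ℕ) :
    shift (lazySteps d) (lazyProj d) ∈ unitary (WalkSpace d (2 * d + 1) →L[ℂ] _) := by
  have hS : shift (lazySteps d) (lazyProj d) =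
      ∑ i : Fin (2 * d + 1), fiberwise (coordProj i) * translate (lazyStep i) := by
    rw [shift_eq_sum]
    exact Finset.sum_congr rfl fun i _ => translate_mul_fiberwise _ _
  have hS' : star (shift (lazySteps d) (lazyProj d)) =
      ∑ i : Fin (2 * d + 1), fiberwise (coordProj i) * translate (-lazyStep i) := by
    rw [hS, star_sum]
    refine Finset.sum_congr rfl fun i _ => ?_
    rw [star_mul, adjoint_translate, adjoint_fiberwise, star_coordProj, translate_mul_fiberwise]
  have key : ∀ a b : Fin (2 * d + 1) → (Fin d → ℤ), (∀ i, a i + b i = 0) →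
      (∑ i, fiberwise (coordProj i) * translate (a i)) *
        (∑ i, fiberwise (coordProj i) * translate (b i)) =
        (1 : WalkSpace d (2 * d + 1) →L[ℂ] WalkSpace d (2 * d + 1)) := by
    intro a b hab
    rw [Finset.sum_mul_sum, ← sum_fiberwise_coordProj]
    refine Finset.sum_congr rfl fun i _ => ?_
    have h : ∀ j, fiberwise (coordProj i) * translate (a i) *
        (fiberwise (coordProj j) * translate (b j)) = if i = j then fiberwise (coordProj i) else
        (0 : WalkSpace d (2 * d + 1) →L[ℂ] WalkSpace d (2 * d + 1)) := by
      intro j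
      rw [mul_assoc, ← mul_assoc (translate (a i)), translate_mul_fiberwise, mul_assoc,
        translate_mul, ← mul_assoc, fiberwise_mul, coordProj_mul]
      split_ifs with hij
      · rw [← hij, hab, translate_zero, mul_one]
      · rw [fiberwise_zero, zero_mul]
    simp [h]
  rw [Unitary.mem_iff, hS', hS]
  exact ⟨key _ _ fun i => neg_add_cancel _, key _ _ fun i => add_neg_cancel _⟩

theorem grover_conjTranspose (D : ℕ) : (grover D).conjTranspose = grover D := by
  ext i j
  by_cases h : i = j
  · simp [grover, h]
  · simp [grover, Matrix.one_apply_ne h, Matrix.one_apply_ne (Ne.symm h)]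

theorem grover_mul_self {D : ℕ} (hD : D ≠ 0) : grover D * grover D = 1 := by
  have hD' : (D : ℂ) ≠ 0 := by exact_mod_cast hD
  have hJ : (Matrix.of fun _ _ => 1 : Matrix (Fin D) (Fin D) ℂ) * (Matrix.of fun _ _ => 1) =
      (D : ℂ) • Matrix.of fun _ _ => 1 := by
    ext i j
    simp [Matrix.mul_apply]
  rw [grover, sub_mul, mul_sub, Matrix.smul_mul, Matrix.mul_smul, hJ, smul_smul, smul_smul,
    one_mul, mul_one]
  have : 2 / (D : ℂ) * (2 / (D : ℂ)) * D = 2 * (2 / (D : ℂ)) := by field_simp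
  rw [this]
  module

theorem lazyGrover_mem_unitary (d : ℕ) :
    lazyGrover d ∈ unitary (WalkSpace d (2 * d + 1) →L[ℂ] WalkSpace d (2 * d + 1)) := by
  refine mul_mem (shift_mem_unitary d) ?_
  have hG : star (Matrix.toEuclideanCLM (𝕜 := ℂ) (grover (2 * d + 1))) =
      Matrix.toEuclideanCLM (𝕜 := ℂ) (grover (2 * d + 1)) := by
    rw [← map_star, Matrix.star_eq_conjTranspose, grover_conjTranspose]
  have hF : (fiberwise (Matrix.toEuclideanCLM (𝕜 := ℂ) (grover (2 * d + 1))) *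
      fiberwise (Matrix.toEuclideanCLM (𝕜 := ℂ) (grover (2 * d + 1))) :
      WalkSpace d (2 * d + 1) →L[ℂ] WalkSpace d (2 * d + 1)) = 1 := by
    rw [fiberwise_mul, ← map_mul, grover_mul_self (by omega), map_one, fiberwise_one]
  rw [Unitary.mem_iff, adjoint_fiberwise, hG]
  exact ⟨hF, hF⟩

theorem inner_lazyGrover {d : ℕ} (f g : WalkSpace d (2 * d + 1)) :
    ⟪lazyGrover d f, lazyGrover d g⟫_ℂ = ⟪f, g⟫_ℂ := by
  have h := (Unitary.mem_iff.1 (lazyGrover_mem_unitary d)).1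
  rw [← ContinuousLinearMap.adjoint_inner_right, ← ContinuousLinearMap.star_eq_adjoint,
    ← mul_apply_eq_comp, h]
  rfl

theorem norm_lazyGrover {d : ℕ} (f : WalkSpace d (2 * d + 1)) : ‖lazyGrover d f‖ = ‖f‖ := by
  rw [norm_eq_sqrt_re_inner (𝕜 := ℂ), inner_lazyGrover, ← norm_eq_sqrt_re_inner]

/-- The walk and the translations are commuting unitaries, so the adjoints commute with all of them
as well. The case `k = l` is the normality of each symbol. -/
theorem commute_star_walkHom {d : ℕ} (k l : WalkSymbol d) :
    Commute (star (walkHom d k)) (walkHom d l) := by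
  have hstar : ∀ α : Multiplicative (Fin d → ℤ), star (walkTranslate d (2 * d + 1) α) =
      walkTranslate d (2 * d + 1) α⁻¹ := fun α => by
    simp [walkTranslate, adjoint_translate]
  have hU : Commute (star (lazyGrover d)) (lazyGrover d) := by
    have h := Unitary.mem_iff.1 (lazyGrover_mem_unitary d)
    exact h.1.trans h.2.symm
  have hUτ : ∀ α, Commute (star (lazyGrover d)) (walkTranslate d _ α) := fun α => by
    have h := (commute_lazyGrover_walkTranslate α⁻¹).star_star
    rwa [hstar, inv_inv] at h
  induction k using AddMonoidAlgebra.induction_linear with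
  | zero => simp
  | add a b ha hb =>
    rw [map_add, star_add]
    exact ha.add_left hb
  | single g c =>
    induction l using AddMonoidAlgebra.induction_linear with
    | zero => simp
    | add a b ha hb =>
      rw [map_add]
      exact ha.add_right hb
    | single g' c' =>
      obtain ⟨n, α⟩ := g
      obtain ⟨m, β⟩ := g'
      rw [walkHom, symbolHom_single, symbolHom_single, star_smul, star_mul, star_pow, hstar]
      refine (Commute.smul_left ?_ _).smul_right _
      refine Commute.mul_left ?_ ?_
      · refine Commute.mul_right (((commute_lazyGrover_walkTranslate _).symm).pow_right m) ?_
        exact (Commute.all _ _).map (walkTranslate d (2 * d + 1))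
      · exact ((hU.pow_right m).mul_right (hUτ _)).pow_left n

/-! ### Injectivity on square-summable functions and the kernel of the velocity -/

theorem eq_zero_of_translation_invariant {d D : ℕ} (f : WalkSpace d D) {α : Fin d → ℤ}
    (hα : α ≠ 0) (h : ∀ x, f (x + α) = f x) : f = 0 := by
  ext1
  funext x
  by_contra hx
  have hn : ∀ n : ℕ, f (x + n • α) = f x := by
    intro n
    induction n with
    | zero => simp
    | succ n ih => rw [succ_nsmul, ← add_assoc, h, ih]
  have hsum := (memℓp_gen_iff (p := 2) (by norm_num)).1 (lp.memℓp f)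
  have hinj : Function.Injective fun n : ℕ => x + n • α := by
    intro a b hab
    obtain ⟨i, hi⟩ := Function.ne_iff.1 hα
    have := congrFun hab i
    simp only [Pi.add_apply, add_right_inj] at this
    have h' : (a : ℤ) * α i = b * α i := by simpa using this
    exact_mod_cast mul_right_cancel₀ hi h'
  have h0 := (hsum.comp_injective hinj).tendsto_atTop_zero
  simp only [Function.comp_def, hn] at h0
  have := tendsto_nhds_unique tendsto_const_nhds h0
  simp at this
  exact hx (by simpa using this)

theorem unitStep_ne_zero {d : ℕ} (j : Fin d) : unitStep j ≠ 0 := fun h => by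
  have := congrFun h j
  simp [unitStep] at this

theorem walkHom_spaceSymbol_apply {d : ℕ} (α : Fin d → ℤ) (f : WalkSpace d (2 * d + 1))
    (x : Fin d → ℤ) : walkHom d (spaceSymbol α) f x = f (x + α) := by
  rw [spaceSymbol, walkHom, symbolHom_single]
  simp [walkTranslate_apply]

theorem walkHom_timeSymbol (d : ℕ) : walkHom d (timeSymbol d) = lazyGrover d := by
  rw [timeSymbol, walkHom, symbolHom_single]
  simp [← Prod.fst_zero]

theorem eq_zero_of_spaceSymbol_sub {d : ℕ} {α β : Fin d → ℤ} (h : α ≠ β)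
    (f : WalkSpace d (2 * d + 1))
    (hf : walkHom d (spaceSymbol α - spaceSymbol β) f = 0) : f = 0 := by
  refine eq_zero_of_translation_invariant f (sub_ne_zero.2 h) fun x => ?_
  have h0 := congrArg (fun g : WalkSpace d (2 * d + 1) => g (x - β)) hf
  simp only [map_sub, sub_apply, lp.coeFn_sub, Pi.sub_apply, walkHom_spaceSymbol_apply] at h0
  rw [sub_add_cancel, show x - β + α = x + (α - β) by abel] at h0
  exact sub_eq_zero.1 h0

theorem spaceSymbol_sub_zero_mul_self {d : ℕ} (i : Fin d) :
    (spaceSymbol (unitStep i) - spaceSymbol 0) * (spaceSymbol (unitStep i) - spaceSymbol 0) =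
      spaceSymbol (unitStep i) * (cosSymbol i - 2) := by
  rw [cosSymbol, spaceSymbol_zero]
  linear_combination -spaceSymbol_neg_mul (unitStep i)

theorem cosSymbol_sub_cosSymbol {d : ℕ} (i l : Fin d) :
    (spaceSymbol (unitStep l) - spaceSymbol (unitStep i)) *
      (spaceSymbol 0 - spaceSymbol (-unitStep l - unitStep i)) = cosSymbol l - cosSymbol i := by
  rw [sub_eq_add_neg (-unitStep l), ← spaceSymbol_mul, cosSymbol, cosSymbol, spaceSymbol_zero]
  linear_combination -spaceSymbol (-unitStep i) * spaceSymbol_neg_mul (unitStep l) +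
    spaceSymbol (-unitStep l) * spaceSymbol_neg_mul (unitStep i)

theorem unitStep_ne_neg_unitStep {d : ℕ} (i : Fin d) : unitStep i ≠ -unitStep i := by
  intro h
  have := congrFun h i
  rw [Pi.neg_apply, unitStep_apply_self] at this
  omega

theorem neg_unitStep_sub_unitStep_ne_zero {d : ℕ} (i l : Fin d) :
    -unitStep l - unitStep i ≠ 0 := by
  intro h
  have := congrFun h l
  have h2 := unitStep_nonneg i l
  simp only [Pi.sub_apply, Pi.neg_apply, unitStep_apply_self, Pi.zero_apply] at this
  omega

/-- Square-summability enters here: `t_i - 2` and `t_l - t_i` factor, up to invertible shifts, into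
differences of two distinct translations. Each difference is injective, because an invariant
function is constant along an infinite orbit. -/
theorem eq_zero_of_walkHom_reducedDisp {d : ℕ} {s : Finset (Fin d)} {j : Fin d} (hj : j ∉ s) (f : WalkSpace d (2 * d + 1))
    (hs : walkHom d (reducedDisp (timeSymbol d) cosSymbol s) f = 0)
    (hjs : walkHom d (reducedDisp (timeSymbol d) cosSymbol (insert j s)) f = 0) : f = 0 := by
  let _ : Module (WalkSymbol d) (WalkSpace d (2 * d + 1)) :=
    Module.compHom _ (walkHom d).toRingHom
  have smul_def : ∀ (k : WalkSymbol d) (u : WalkSpace d (2 * d + 1)), k • u = walkHom d k u :=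
    fun _ _ => rfl
  rw [← smul_def] at hs hjs
  have hsub : ∀ {α β : Fin d → ℤ}, α ≠ β → ∀ u : WalkSpace d (2 * d + 1),
      (spaceSymbol α - spaceSymbol β) • u = 0 → u = 0 :=
    fun h u hu => eq_zero_of_spaceSymbol_sub h u (by rwa [smul_def] at hu)
  refine eq_zero_of_reducedDisp_smul hj ?_ ?_ ?_ ?_ f hs hjs
  · intro u hu
    rw [two_smul, ← two_smul ℂ] at hu
    exact (smul_eq_zero.1 hu).resolve_left two_ne_zero
  · intro u hu
    rw [smul_def, walkHom_timeSymbol] at hu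
    rw [← norm_eq_zero, ← norm_lazyGrover, hu, norm_zero]
  · intro i _ u hu
    refine hsub (unitStep_ne_zero i) u (hsub (unitStep_ne_zero i) _ ?_)
    rw [← mul_smul, spaceSymbol_sub_zero_mul_self, mul_smul, hu, smul_zero]
  · intro i _ l _ hli u hu
    refine hsub (neg_unitStep_sub_unitStep_ne_zero i l).symm u
      (hsub (fun h => hli (unitStep_injective h)) _ ?_)
    rw [← mul_smul, cosSymbol_sub_cosSymbol, hu]

theorem velocitySymbol_eq {d : ℕ} (j : Fin d) :
    velocitySymbol j = (spaceSymbol (unitStep j) - spaceSymbol (-unitStep j)) * (timeSymbol d *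
      (reducedDisp (timeSymbol d) cosSymbol (Finset.univ.erase j) * (timeSymbol d - 1))) := by
  unfold velocitySymbol
  ring

/-- In `v = (z_j⁻¹ - z_j) T R_{≠j} (T - 1)` the first two factors are injective, so `(T - 1) f` is
killed by `R_{≠j}`. The dispersion relation says that it is also killed by the full `R`. -/
theorem lazyGrover_apply_eq_of_velocity {d : ℕ} (j : Fin d) (f : WalkSpace d (2 * d + 1))
    (hf : walkHom d (velocitySymbol j) f = 0) : lazyGrover d f = f := by
  have hdisp : walkHom d (reducedDisp (timeSymbol d) cosSymbol Finset.univ * (timeSymbol d - 1)) f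
      = 0 := by
    rw [mul_comm (reducedDisp _ _ _), ← dispSymbol, walkHom_dispSymbol, zero_apply]
  rw [velocitySymbol_eq, map_mul, mul_apply_eq_comp] at hf
  have h2 := eq_zero_of_spaceSymbol_sub (unitStep_ne_neg_unitStep j) _ hf
  rw [map_mul, walkHom_timeSymbol, mul_apply_eq_comp, ← norm_eq_zero, norm_lazyGrover,
    norm_eq_zero, map_mul, mul_apply_eq_comp] at h2
  rw [map_mul, mul_apply_eq_comp, ← Finset.insert_erase (Finset.mem_univ j)] at hdisp
  have h1 := eq_zero_of_walkHom_reducedDisp (Finset.notMem_erase j Finset.univ) _ h2 hdisp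
  rw [map_sub, walkHom_timeSymbol, map_one, sub_apply, one_apply_eq_self] at h1
  exact sub_eq_zero.1 h1

/-! ### The eigenvalue 1 -/

/-- A stationary state of the lazy Grover walk, supported on the cube `{0, 1}ᵈ`. -/
noncomputable def cubeState (d : ℕ) : StateField d := fun x =>
  WithLp.toLp 2 fun i =>
    if x ∈ Finset.Icc 0 1 then
      if h : i.val < d then if x ⟨i.val, h⟩ = 1 then 2 else 0
      else if h' : i.val = d then 1
      else if x ⟨i.val - (d + 1), by omega⟩ = 0 then 2 else 0
    else 0

theorem cubeState_posIdx {d : ℕ} (x : Fin d → ℤ) (j : Fin d) :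
    cubeState d x (posIdx j) = if x ∈ Finset.Icc 0 1 then if x j = 1 then 2 else 0 else 0 := by
  simp [cubeState, posIdx]

theorem cubeState_zeroIdx {d : ℕ} (x : Fin d → ℤ) :
    cubeState d x (zeroIdx d) = if x ∈ Finset.Icc 0 1 then 1 else 0 := by
  simp [cubeState, zeroIdx]

theorem cubeState_negIdx {d : ℕ} (x : Fin d → ℤ) (j : Fin d) :
    cubeState d x (negIdx j) = if x ∈ Finset.Icc 0 1 then if x j = 0 then 2 else 0 else 0 := by
  have h1 : ¬ d + 1 + j.val < d := by omega
  have h2 : ¬ d + 1 + j.val = d := by omega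
  simp [cubeState, negIdx, h1, h2]

theorem mem_cube {d : ℕ} (x : Fin d → ℤ) :
    x ∈ Finset.Icc 0 1 ↔ ∀ j, x j = 0 ∨ x j = 1 := by
  rw [Finset.mem_Icc, Pi.le_def, Pi.le_def, ← forall_and]
  refine forall_congr' fun j => ?_
  simp only [Pi.zero_apply, Pi.one_apply]
  omega

theorem sum_cubeState {d : ℕ} (x : Fin d → ℤ) :
    2 / (2 * d + 1 : ℂ) * ∑ l, cubeState d x l = if x ∈ Finset.Icc 0 1 then 2 else 0 := by
  have hd : (2 * d + 1 : ℂ) ≠ 0 := by exact_mod_cast (Nat.succ_ne_zero (2 * d))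
  rw [sum_idx]
  simp only [cubeState_posIdx, cubeState_negIdx, cubeState_zeroIdx]
  by_cases hx : x ∈ Finset.Icc 0 1
  · have h : ∀ j : Fin d, ((if x j = 1 then 2 else 0) + (if x j = 0 then 2 else 0) : ℂ) = 2 := by
      intro j
      rcases (mem_cube x).1 hx j with h | h <;> simp [h]
    simp only [hx, if_true, h]
    simp
    field_simp
  · simp [hx]

theorem mem_cube_shift_iff {d : ℕ} (x : Fin d → ℤ) (j : Fin d) :
    (x - unitStep j ∈ Finset.Icc 0 1 ∧ (x - unitStep j) j = 0) ↔
      (x ∈ Finset.Icc 0 1 ∧ x j = 1) := by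
  have hne : ∀ l, l ≠ j → unitStep j l = 0 := fun l hl => by simp [unitStep, hl]
  simp only [mem_cube, Pi.sub_apply, unitStep_apply_self]
  constructor
  · rintro ⟨h, hj⟩
    refine ⟨fun l => ?_, by omega⟩
    rcases eq_or_ne l j with rfl | hl
    · right; omega
    · simpa [hne l hl] using h l
  · rintro ⟨h, hj⟩
    refine ⟨fun l => ?_, by omega⟩
    rcases eq_or_ne l j with rfl | hl
    · left; rw [unitStep_apply_self]; omega
    · simpa [hne l hl] using h l

theorem two_sub_ite_cube {d : ℕ} (x : Fin d → ℤ) (j : Fin d) (a b : ℤ)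
    (hab : a = 0 ∧ b = 1 ∨ a = 1 ∧ b = 0) :
    ((if x ∈ Finset.Icc 0 1 then 2 else 0) -
      (if x ∈ Finset.Icc 0 1 then if x j = a then 2 else 0 else 0) : ℂ) =
      if x ∈ Finset.Icc 0 1 ∧ x j = b then 2 else 0 := by
  by_cases hx : x ∈ Finset.Icc 0 1
  · rcases (mem_cube x).1 hx j with h | h <;> rcases hab with ⟨rfl, rfl⟩ | ⟨rfl, rfl⟩ <;>
      simp [hx, h]
  · simp [hx]

/-- On the cube the components sum to `2d + 1`, so the coin acts as `a ↦ 2 - a`: it exchanges 0 and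
2 and fixes the resting component 1. The shift along each edge of the cube then undoes the exchange,
and nothing leaves the cube. -/
theorem step_cubeState (d : ℕ) : step d (cubeState d) = cubeState d := by
  funext x
  ext k
  rw [step_apply_apply, sum_cubeState]
  rcases idx_cases k with ⟨j, rfl⟩ | rfl | ⟨j, rfl⟩
  · rw [lazyStep_posIdx, cubeState_posIdx, cubeState_posIdx,
      two_sub_ite_cube _ _ 1 0 (Or.inr ⟨rfl, rfl⟩), ← ite_and]
    exact if_congr (mem_cube_shift_iff x j) rfl rfl
  · rw [lazyStep_zeroIdx, sub_zero, cubeState_zeroIdx]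
    split_ifs <;> norm_num
  · rw [lazyStep_negIdx, cubeState_negIdx, cubeState_negIdx,
      two_sub_ite_cube _ _ 0 1 (Or.inl ⟨rfl, rfl⟩), ← ite_and]
    have h := mem_cube_shift_iff (x - -unitStep j) j
    rw [sub_neg_eq_add, add_sub_cancel_right] at h
    rw [sub_neg_eq_add]
    exact if_congr h.symm rfl rfl

theorem hasEigenvalue_lazyGrover_one (d : ℕ) :
    Module.End.HasEigenvalue
      (lazyGrover d : WalkSpace d (2 * d + 1) →ₗ[ℂ] WalkSpace d (2 * d + 1)) 1 := by
  have hs : (Function.support (cubeState d)).Finite := by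
    refine (Finset.finite_toSet (Finset.Icc (0 : Fin d → ℤ) 1)).subset fun x hx => ?_
    by_contra h
    refine hx ?_
    ext i
    have h' : x ∉ Finset.Icc 0 1 := h
    simp only [cubeState, if_neg h', PiLp.zero_apply]
  let f : WalkSpace d (2 * d + 1) := ⟨_, memlp_of_finite_support hs⟩
  refine Module.End.hasEigenvalue_of_hasEigenvector (x := f)
    ⟨Module.End.mem_eigenspace_iff.2 ?_, fun h0 => ?_⟩
  · rw [one_smul]
    ext1
    change ⇑(lazyGrover d f) = ⇑f
    rw [coe_lazyGrover]
    exact step_cubeState d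
  · have h1 : cubeState d 0 = 0 := congrArg (fun g : WalkSpace d (2 * d + 1) => g 0) h0
    have h2 := cubeState_zeroIdx (0 : Fin d → ℤ)
    rw [h1, if_pos ((mem_cube 0).2 fun _ => Or.inl rfl)] at h2
    simp at h2

theorem mem_eigenspace_lazyGrover_one {d : ℕ} {f : WalkSpace d (2 * d + 1)} :
    f ∈ eigenspace (lazyGrover d) 1 ↔ lazyGrover d f = f := by
  rw [Module.End.mem_eigenspace_iff, one_smul]
  rfl

/-! ### Pointwise decay off the eigenspace, and the limit -/

/-- The square-summable functions whose evolution tends to zero pointwise. -/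
noncomputable def decaying (d : ℕ) : Submodule ℂ (WalkSpace d (2 * d + 1)) where
  carrier := {f | ∀ x, Filter.Tendsto (fun n : ℕ => (lazyGrover d ^ n) f x)
    Filter.atTop (nhds 0)}
  zero_mem' x := by simp
  add_mem' {f g} hf hg x := by
    simpa only [map_add, lp.coeFn_add, Pi.add_apply, add_zero] using (hf x).add (hg x)
  smul_mem' c f hf x := by
    simpa only [map_smul, lp.coeFn_smul, Pi.smul_apply, smul_zero] using (hf x).const_smul c

theorem isClosed_decaying (d : ℕ) : IsClosed (decaying d : Set (WalkSpace d (2 * d + 1))) := by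
  refine isClosed_of_closure_subset fun f hf x => ?_
  rw [Metric.tendsto_atTop]
  intro ε hε
  obtain ⟨g, hg, hfg⟩ := Metric.mem_closure_iff.1 hf (ε / 2) (by positivity)
  obtain ⟨N, hN⟩ := Metric.tendsto_atTop.1 (hg x) (ε / 2) (by positivity)
  refine ⟨N, fun n hn => ?_⟩
  have h1 := hN n hn
  rw [dist_zero_right] at h1 ⊢
  have h2 : ‖(lazyGrover d ^ n) (f - g) x‖ ≤ ‖f - g‖ := by
    rw [← norm_lazyGrover_pow_apply norm_lazyGrover n (f - g)]
    exact lp.norm_apply_le_norm (by norm_num) _ x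
  have h3 : (lazyGrover d ^ n) f x = (lazyGrover d ^ n) (f - g) x + (lazyGrover d ^ n) g x := by
    rw [map_sub, lp.coeFn_sub, Pi.sub_apply, sub_add_cancel]
  rw [h3]
  rw [dist_eq_norm] at hfg
  exact (norm_add_le _ _).trans_lt (by linarith)

/-- The decay rate is known only for finite support; expanding `f` into its values at single sites
and using that the decaying functions form a closed subspace covers all `f`. -/
theorem walkHom_velocity_mem_decaying {d : ℕ} (j : Fin d) (f : WalkSpace d (2 * d + 1)) :
    walkHom d (velocitySymbol j) f ∈ decaying d := by
  have h := (lp.hasSum_single (p := 2) (by norm_num) f).mapL (walkHom d (velocitySymbol j))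
  refine (isClosed_decaying d).mem_of_tendsto h (Filter.Eventually.of_forall fun s => ?_)
  refine sum_mem fun y _ x => ?_
  refine tendsto_lazyGrover_pow_velocity norm_lazyGrover j _ ?_ x
  refine (Set.finite_singleton y).subset fun z hz => ?_
  by_contra hzy
  exact hz (lp.single_apply_ne (E := fun _ => EuclideanSpace ℂ (Fin (2 * d + 1))) 2 y (f y) hzy)

theorem orthogonal_eigenspace_le_decaying {d : ℕ} (hd : 1 ≤ d) :
    (eigenspace (lazyGrover d) 1)ᗮ ≤ decaying d := by
  let j : Fin d := ⟨0, hd⟩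
  have hn : IsStarNormal (walkHom d (velocitySymbol j)) := ⟨commute_star_walkHom _ _⟩
  have hk : (walkHom d (velocitySymbol j)).rangeᗮ ≤ eigenspace (lazyGrover d) 1 := by
    -- For a normal operator the orthogonal complement of the range is the kernel of the operator
    -- itself.
    rw [ContinuousLinearMap.IsStarNormal.orthogonal_range hn]
    intro f hf
    exact mem_eigenspace_lazyGrover_one.2 (lazyGrover_apply_eq_of_velocity j f hf)
  have h2 := Submodule.orthogonal_le hk
  rw [Submodule.orthogonal_orthogonal_eq_closure] at h2
  refine h2.trans (Submodule.topologicalClosure_minimal _ ?_ (isClosed_decaying d))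
  rintro _ ⟨f, rfl⟩
  exact walkHom_velocity_mem_decaying j f

/-- An eigenvector for `ω ≠ 1` is orthogonal to the eigenspace for 1, so it decays pointwise; but
`|ωⁿ f(x)| = |f(x)|` for all `n`. -/
theorem eq_one_of_hasEigenvalue_lazyGrover {d : ℕ} (hd : 1 ≤ d) {ω : ℂ}
    (h : Module.End.HasEigenvalue
      (lazyGrover d : WalkSpace d (2 * d + 1) →ₗ[ℂ] WalkSpace d (2 * d + 1)) ω) : ω = 1 := by
  by_contra hω
  obtain ⟨f, hf⟩ := h.exists_hasEigenvector
  have hUf : lazyGrover d f = ω • f := hf.apply_eq_smul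
  have hnorm : ‖ω‖ = 1 := by
    have h1 := norm_lazyGrover f
    rw [hUf, norm_smul] at h1
    exact mul_right_cancel₀ (norm_ne_zero_iff.2 hf.2) (h1.trans (one_mul _).symm)
  have horth : f ∈ (eigenspace (lazyGrover d) 1)ᗮ := by
    refine (Submodule.mem_orthogonal _ _).2 fun g hg => ?_
    have h1 := inner_lazyGrover g f
    rw [mem_eigenspace_lazyGrover_one.1 hg, hUf, inner_smul_right] at h1
    have h2 : (ω - 1) * ⟪g, f⟫_ℂ = 0 := by rw [sub_mul, h1, one_mul, sub_self]
    exact (mul_eq_zero.1 h2).resolve_left (sub_ne_zero.2 hω)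
  have hpow : ∀ n : ℕ, (lazyGrover d ^ n) f = ω ^ n • f := by
    intro n
    induction n with
    | zero => simp
    | succ n ih => rw [pow_succ', mul_apply_eq_comp, ih, map_smul, hUf, smul_smul, ← pow_succ]
  refine hf.2 ?_
  ext1
  funext x
  have h1 := (orthogonal_eigenspace_le_decaying hd horth x).norm
  simp only [hpow, lp.coeFn_smul, Pi.smul_apply, norm_smul, norm_pow, hnorm, one_pow, one_mul,
    norm_zero] at h1
  exact norm_eq_zero.1 (tendsto_nhds_unique tendsto_const_nhds h1)

theorem tendsto_lazyGrover_pow_apply {d : ℕ} (hd : 1 ≤ d) (f : WalkSpace d (2 * d + 1))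
    (x : Fin d → ℤ) :
    Filter.Tendsto (fun n : ℕ => (lazyGrover d ^ n) f x) Filter.atTop
      (nhds (eigenProj (lazyGrover d) 1 f x)) := by
  have hp : lazyGrover d (eigenProj (lazyGrover d) 1 f) = eigenProj (lazyGrover d) 1 f :=
    mem_eigenspace_lazyGrover_one.1 (Submodule.starProjection_apply_mem _ f)
  have hpow : ∀ n : ℕ, (lazyGrover d ^ n) (eigenProj (lazyGrover d) 1 f) =
      eigenProj (lazyGrover d) 1 f := by
    intro n
    induction n with
    | zero => rfl
    | succ n ih => rw [pow_succ, mul_apply_eq_comp, hp, ih]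
  have h1 := orthogonal_eigenspace_le_decaying hd
    (Submodule.sub_starProjection_mem_orthogonal (K := eigenspace (lazyGrover d) 1) f) x
  have h2 := h1.const_add (eigenProj (lazyGrover d) 1 f x)
  rw [add_zero] at h2
  refine h2.congr fun n => ?_
  change _ + (lazyGrover d ^ n) (f - eigenProj (lazyGrover d) 1 f) x = _
  rw [map_sub, hpow, lp.coeFn_sub, Pi.sub_apply, add_sub_cancel]

end QuantumWalk

theorem theorem1p4 (d : ℕ) (hd : 1 ≤ d) :
    (∀ ω : ℂ, Module.End.HasEigenvalue
        (QuantumWalk.lazyGrover d : WalkSpace d (2 * d + 1) →ₗ[ℂ] WalkSpace d (2 * d + 1)) ω ↔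
      ω = 1) ∧
    ∀ (φ : EuclideanSpace ℂ (Fin (2 * d + 1))) (x : Fin d → ℤ),
      Filter.Tendsto (fun n : ℕ => QuantumWalk.prob (QuantumWalk.lazyGrover d) n φ x) Filter.atTop
        (nhds (‖QuantumWalk.eigenProj (QuantumWalk.lazyGrover d) 1
          (QuantumWalk.deltaState 0 φ) x‖ ^ 2)) := by
  refine ⟨fun ω => ⟨QuantumWalk.eq_one_of_hasEigenvalue_lazyGrover hd, ?_⟩, fun φ x => ?_⟩
  · rintro rfl
    exact QuantumWalk.hasEigenvalue_lazyGrover_one d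
  · exact (QuantumWalk.tendsto_lazyGrover_pow_apply hd _ x).norm.pow 2
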